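/- Let $1<p<\infty$ and $N\ge 1$. For an open set $\Omega\subset\mathbb{R}^N$ let $$\lambda_p(\Omega)=\inf_{u\in C_0^\infty(\Omega)\setminus\{0\}}\frac{\int_\Omega|\nabla u|^p\,dx}{\int_\Omega|u|^p\,dx}\in[0,+\infty]$$ (with $\inf\emptyset=+\infty$), where $C_0^\infty(\Omega)$ is the set of smooth real functions with compact support in $\Omega$. Let $R_\Omega\in[0,+\infty]$ be the inradius of $\Omega$, i.e. the supremum of the radii of the open balls contained in $\Omega$ (with $R_\emptyset=0$), and let $$\pi_p=\inf\left\{\frac{\|\varphi'\|_{L^p([0,1])}}{\|\varphi\|_{L^p([0,1])}}\ :\ \varphi\in C^1([0,1])\setminus\{0\},\ \varphi(0)=\varphi(1)=0\right\}.$$ **Theorem.** For every open convex set $\Omega\subset\mathbb{R}^N$, $$\lambda_p(\Omega)\ \ge\ \left(\frac{\pi_p}{2}\right)^p\frac{1}{R_\Omega^p},$$ with the conventions $1/0=+\infty$ and $1/\infty=0$. The estimate is sharp: 1. equality holds for every slab $\Omega=\{x\in\mathbb{R}^N: a<\langle x,\omega\rangle<b\}$ with $a<b$ and $\omega\in\mathbb{R}^N$,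 $|\omega|=1$; 2. for $k\ge1$ and $\alpha>0$ let $C^k_\alpha\subset\mathbb{R}^k$ be the interior of the convex hull of $\big((-1,1)^{k-1}\times\{0\}\big)\cup\{(0,\dots,0,\alpha)\}$; then $$\lim_{\alpha\to0^+}R_{C^N_\alpha}^p\,\lambda_p(C^N_\alpha)=\left(\frac{\pi_p}{2}\right)^p;$$ 3. for every integer $k$ with $2\le k\le N-1$, $$\lim_{\alpha\to0^+}R_{\mathbb{R}^{N-k}\times C^k_\alpha}^p\,\lambda_p(\mathbb{R}^{N-k}\times C^k_\alpha)=\left(\frac{\pi_p}{2}\right)^p.$$ -/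

import Mathlib

open MeasureTheory Filter Topology
open scoped ContDiff ENNReal

/-- `u` is a nonzero element of `C_0^∞(Ω)`: a smooth function on `ℝ^N`, not identically zero,
whose support is compact and contained in `Ω`. -/
def IsTestFunction {N : ℕ} (Ω : Set (EuclideanSpace ℝ (Fin N)))
    (u : EuclideanSpace ℝ (Fin N) → ℝ) : Prop :=
  ContDiff ℝ ∞ u ∧ HasCompactSupport u ∧ tsupport u ⊆ Ω ∧ u ≠ 0

/-- The first Dirichlet eigenvalue of the `p`-Laplacian: the infimum of the Rayleigh quotients
`∫_Ω |∇u|^p / ∫_Ω |u|^p` over nonzero `u ∈ C_0^∞(Ω)`. For such `u` both integrals are finite and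
the denominator is positive. The infimum is `∞` when there is no such `u`, i.e. for `Ω = ∅`. -/
noncomputable def firstEigenvalue {N : ℕ} (p : ℝ) (Ω : Set (EuclideanSpace ℝ (Fin N))) : ℝ≥0∞ :=
  ⨅ (u : EuclideanSpace ℝ (Fin N) → ℝ) (_ : IsTestFunction Ω u),
    (∫⁻ x in Ω, ‖gradient u x‖ₑ ^ p) / (∫⁻ x in Ω, ‖u x‖ₑ ^ p)

/-- The inradius of `Ω`: the supremum of the radii of the open balls contained in `Ω`
(possibly `∞`). -/
noncomputable def inradius {N : ℕ} (Ω : Set (EuclideanSpace ℝ (Fin N))) : ℝ≥0∞ :=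
  ⨆ (x : EuclideanSpace ℝ (Fin N)) (r : ℝ) (_ : Metric.ball x r ⊆ Ω), ENNReal.ofReal r

/-- `φ` is a nonzero element of `C^1([0,1])` with `φ(0) = φ(1) = 0`. (The values of `φ` outside
`[0,1]` are irrelevant.) -/
def IsPoincareAdmissible (φ : ℝ → ℝ) : Prop :=
  ContDiffOn ℝ 1 φ (Set.Icc 0 1) ∧ φ 0 = 0 ∧ φ 1 = 0 ∧ ∃ t ∈ Set.Icc (0 : ℝ) 1, φ t ≠ 0

/-- The one-dimensional Poincaré constant `π_p`: the infimum of
`‖φ'‖_{L^p([0,1])} / ‖φ‖_{L^p([0,1])}` over the admissible `φ`. -/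
noncomputable def poincareConst (p : ℝ) : ℝ≥0∞ :=
  ⨅ (φ : ℝ → ℝ) (_ : IsPoincareAdmissible φ),
    eLpNorm (derivWithin φ (Set.Icc 0 1)) (ENNReal.ofReal p) (volume.restrict (Set.Icc 0 1)) /
      eLpNorm φ (ENNReal.ofReal p) (volume.restrict (Set.Icc 0 1))

/-- The slab `{x : a < ⟨x, v⟩ < b}` in `ℝ^N`. -/
def slab {N : ℕ} (v : EuclideanSpace ℝ (Fin N)) (a b : ℝ) : Set (EuclideanSpace ℝ (Fin N)) :=
  {x | a < inner ℝ x v ∧ inner ℝ x v < b}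

/-- The cube `(-1,1)^{k-1}`, seen as the subset `(-1,1)^{k-1} × {0}` of `ℝ^k`. The last coordinate
is the one whose index `i` satisfies `i + 1 = k`. -/
def pyramidBase (k : ℕ) : Set (EuclideanSpace ℝ (Fin k)) :=
  {x | ∀ i : Fin k, ((i : ℕ) + 1 < k → -1 < x i ∧ x i < 1) ∧ ((i : ℕ) + 1 = k → x i = 0)}

/-- The point `(0,…,0,α)` of `ℝ^k`. -/
noncomputable def pyramidApex (k : ℕ) (α : ℝ) : EuclideanSpace ℝ (Fin k) :=
  WithLp.toLp 2 (fun i : Fin k => if (i : ℕ) + 1 = k then α else 0)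

/-- The open pyramid `C_α` in `ℝ^k`: the interior of the convex hull of `(-1,1)^{k-1} × {0}` and
`(0,…,0,α)`. The interior is taken because eigenvalues are considered on open sets. -/
def pyramid (k : ℕ) (α : ℝ) : Set (EuclideanSpace ℝ (Fin k)) :=
  interior (convexHull ℝ (pyramidBase k ∪ {pyramidApex k α}))

/-- The last `k` coordinates of a point of `ℝ^N`, as a point of `ℝ^k`. -/
def lastCoords {N k : ℕ} (h : k ≤ N) (x : EuclideanSpace ℝ (Fin N)) : EuclideanSpace ℝ (Fin k) :=
  WithLp.toLp 2 (fun i : Fin k => x ⟨N - k + i, by omega⟩)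

/-- The set `ℝ^{N-k} × D` in `ℝ^N`, for `D ⊆ ℝ^k`. -/
def euclideanCylinder {N k : ℕ} (h : k ≤ N) (D : Set (EuclideanSpace ℝ (Fin k))) :
    Set (EuclideanSpace ℝ (Fin N)) :=
  {x | lastCoords h x ∈ D}

/-! ### Slicing along a direction, and dilations -/

section Slicing

variable {E : Type*} [NormedAddCommGroup E] [InnerProductSpace ℝ E] [FiniteDimensional ℝ E]
  [MeasurableSpace E] [BorelSpace E]

/-! Lower bound. Let `R` exceed the inradius and let `u` be a test function. The ball of radius `R`
about a point of `Ω` leaves `Ω`, so Hahn–Banach gives a half-space containing `Ω` whose boundary is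
closer than `R` to that point; by compactness finitely many half-spaces serve the whole support of
`u`. Cut the support into cells according to the nearest bounding hyperplane. Moving from a point of
a cell straight towards its hyperplane never leaves the cell, so the cell is a union of normal
segments of length at most `R` that start on the hyperplane, where `u` vanishes because the
hyperplane misses `Ω`. On a segment of length `l` with a zero at one end only, even reflection about
the other end gives the Poincaré constant `π_p / (2l) ≥ π_p / (2R)`. Integrating over the segments,
summing over the cells and letting `R` decrease to the inradius gives the estimate. The carriers are
`poincareConst_rpow_mul_le_half`, `poincareConst_rpow_mul_setLIntegral_le` and
`poincareConst_rpow_mul_lintegral_le`.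

Sharpness. In a box of width `d`, take the product of a rescaled one-dimensional almost-minimizer
and a fixed transverse cutoff. Minkowski's inequality gives `λ_p^(1/p) ≤ q / d + B` for any `q >
π_p`, with `B` independent of `d` (`exists_firstEigenvalue_rpow_le`), so `B` is negligible for thin
boxes. A slab becomes thin by dilation. A pyramid of height `α` lies in a slab of width `α` and
contains boxes of height `(1 - ε) α` whose transverse size does not depend on `α`. -/

omit [FiniteDimensional ℝ E] [MeasurableSpace E] [BorelSpace E] in
theorem inner_add_smul_of_norm_eq_one {v : E} (hv : ‖v‖ = 1) (x : E) (t : ℝ) :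
    inner ℝ (x + t • v) v = inner ℝ x v + t := by
  rw [inner_add_left, real_inner_smul_left, real_inner_self_eq_norm_sq, hv]
  ring

/-- Integrating over all of `E` is the same as integrating, over the base points `x` in the slab
`0 ≤ ⟨x, v⟩ < 1`, the integral over the line through `x` in the direction `v`. -/
theorem lintegral_eq_lintegral_slices {v : E} (hv : ‖v‖ = 1) {F : E → ℝ≥0∞} (hF : Measurable F) :
    ∫⁻ x, F x = ∫⁻ x in {x : E | inner ℝ x v ∈ Set.Ico (0 : ℝ) 1}, ∫⁻ t : ℝ, F (x + t • v) := by
  have hA : MeasurableSet {x : E | inner ℝ x v ∈ Set.Ico (0 : ℝ) 1} :=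
    measurableSet_Ico.preimage (by fun_prop : Measurable fun x : E => inner ℝ x v)
  set I : ℝ → ℝ≥0∞ := (Set.Ico (0 : ℝ) 1).indicator 1 with hI
  have hIm : Measurable I := measurable_one.indicator measurableSet_Ico
  have hm : Measurable fun z : E × ℝ => I (inner ℝ z.1 v) * F (z.1 + z.2 • v) :=
    (hIm.comp (by fun_prop)).mul (hF.comp (by fun_prop))
  have hm' : Measurable fun z : E × ℝ => I (inner ℝ z.1 v - z.2) * F z.1 :=
    (hIm.comp (by fun_prop)).mul (hF.comp (by fun_prop))
  -- Insert `1 = ∫ I(⟨x, v⟩ - t) dt`, exchange the integrals, and translate by `t • v`. This is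
  -- Fubini along `v` without a splitting of the space into coordinates.
  calc ∫⁻ x, F x = ∫⁻ x, ∫⁻ t : ℝ, I (inner ℝ x v - t) * F x := by
        refine lintegral_congr fun x => ?_
        rw [lintegral_mul_const _ (by fun_prop),
          lintegral_sub_left_eq_self I, hI, lintegral_indicator_one measurableSet_Ico]
        simp
    _ = ∫⁻ t : ℝ, ∫⁻ x, I (inner ℝ x v - t) * F x :=
        lintegral_lintegral_swap hm'.aemeasurable
    _ = ∫⁻ t : ℝ, ∫⁻ x, I (inner ℝ x v) * F (x + t • v) := by
        refine lintegral_congr fun t => ?_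
        rw [← lintegral_add_right_eq_self (fun x => I (inner ℝ x v - t) * F x) (t • v)]
        refine lintegral_congr fun x => ?_
        rw [inner_add_smul_of_norm_eq_one hv, add_sub_cancel_right]
    _ = ∫⁻ x, ∫⁻ t : ℝ, I (inner ℝ x v) * F (x + t • v) :=
        (lintegral_lintegral_swap hm.aemeasurable).symm
    _ = _ := by
        rw [← lintegral_indicator hA]
        refine lintegral_congr fun x => ?_
        rw [lintegral_const_mul _ (by fun_prop)]
        by_cases hx : (inner ℝ x v : ℝ) ∈ Set.Ico (0 : ℝ) 1
        · rw [Set.indicator_of_mem (show x ∈ {x : E | inner ℝ x v ∈ Set.Ico (0 : ℝ) 1} from hx), hI,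
            Set.indicator_of_mem hx]
          simp
        · rw [Set.indicator_of_notMem
            (show x ∉ {x : E | inner ℝ x v ∈ Set.Ico (0 : ℝ) 1} from hx), hI,
            Set.indicator_of_notMem hx]
          simp

theorem mul_lintegral_le_of_slices {v : E} (hv : ‖v‖ = 1) {F G : E → ℝ≥0∞} (hF : Measurable F)
    (hG : Measurable G) (C : ℝ≥0∞)
    (h : ∀ x, C * ∫⁻ t : ℝ, F (x + t • v) ≤ ∫⁻ t : ℝ, G (x + t • v)) :
    C * ∫⁻ x, F x ≤ ∫⁻ x, G x := by
  rw [← lintegral_const_mul C hF, lintegral_eq_lintegral_slices hv (hF.const_mul C),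
    lintegral_eq_lintegral_slices hv hG]
  refine lintegral_mono fun x => ?_
  rw [lintegral_const_mul _ (by fun_prop)]
  exact h x

/-- Fubini for products: since `g` is constant along `v`, its integral over the slab of unit width
plays the role of the integral over the hyperplane orthogonal to `v`. -/
theorem lintegral_comp_inner_mul {v : E} (hv : ‖v‖ = 1) {f : ℝ → ℝ≥0∞} (hf : Measurable f)
    {g : E → ℝ≥0∞} (hg : Measurable g) (hgv : ∀ x (t : ℝ), g (x + t • v) = g x) :
    ∫⁻ x, f (inner ℝ x v) * g x =
      (∫⁻ t, f t) * ∫⁻ x in {x : E | inner ℝ x v ∈ Set.Ico (0 : ℝ) 1}, g x := by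
  rw [lintegral_eq_lintegral_slices hv (by fun_prop),
    ← lintegral_const_mul _ hg]
  refine lintegral_congr fun x => ?_
  simp only [hgv, inner_add_smul_of_norm_eq_one hv]
  rw [lintegral_mul_const _ (by fun_prop), lintegral_add_left_eq_self f]

end Slicing

theorem lintegral_comp_smul_addHaar {E : Type*} [NormedAddCommGroup E] [NormedSpace ℝ E]
    [FiniteDimensional ℝ E] [MeasurableSpace E] [BorelSpace E] (μ : Measure E) [μ.IsAddHaarMeasure]
    (F : E → ℝ≥0∞) {r : ℝ} (hr : r ≠ 0) :
    ∫⁻ x, F (r • x) ∂μ = ENNReal.ofReal |(r ^ Module.finrank ℝ E)⁻¹| * ∫⁻ x, F x ∂μ := by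
  rw [← smul_eq_mul, ← lintegral_smul_measure, ← Measure.map_addHaar_smul μ hr]
  exact ((MeasurableEquiv.smul₀ r hr).measurableEmbedding.lintegral_map F).symm

/-! ### The one-dimensional Poincaré inequality -/

theorem setLIntegral_Icc_zero_one_of_symm {F : ℝ → ℝ≥0∞} (hF : ∀ t, F (1 - t) = F t) :
    ∫⁻ t in Set.Icc (0 : ℝ) 1, F t = 2 * ∫⁻ t in Set.Icc (0 : ℝ) (1 / 2), F t := by
  have hU : Set.Icc (0 : ℝ) 1 = Set.Icc 0 (1 / 2) ∪ Set.Ioc (1 / 2) 1 :=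
    (Set.Icc_union_Ioc_eq_Icc (by norm_num) (by norm_num)).symm
  have hd : Disjoint (Set.Icc (0 : ℝ) (1 / 2)) (Set.Ioc (1 / 2) 1) :=
    Set.disjoint_left.2 fun x hx hx' => absurd hx'.1 (not_lt.2 hx.2)
  rw [hU, lintegral_union measurableSet_Ioc hd, two_mul]
  congr 1
  -- The reflection `t ↦ 1 - t` maps `[0, 1/2)` onto `(1/2, 1]`; the closed half-interval is traded
  -- for the half-open one at the cost of a null set.
  rw [← lintegral_indicator measurableSet_Ioc, restrict_Ico_eq_restrict_Icc.symm,
    ← lintegral_indicator measurableSet_Ico,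
    ← lintegral_sub_left_eq_self ((Set.Ioc (1 / 2 : ℝ) 1).indicator _) 1]
  refine lintegral_congr fun t => ?_
  by_cases ht : t ∈ Set.Ico (0 : ℝ) (1 / 2)
  · rw [Set.indicator_of_mem ht, Set.indicator_of_mem, hF]
    constructor <;> linarith [ht.1, ht.2]
  · rw [Set.indicator_of_notMem ht, Set.indicator_of_notMem]
    exact fun h => ht ⟨by linarith [h.2], by linarith [h.1]⟩

theorem poincareConst_rpow_mul_le {p : ℝ} (hp : 1 < p) {φ : ℝ → ℝ}
    (h1 : ContDiffOn ℝ 1 φ (Set.Icc 0 1)) (h0 : φ 0 = 0) (h01 : φ 1 = 0) :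
    poincareConst p ^ p * ∫⁻ t in Set.Icc (0 : ℝ) 1, ‖φ t‖ₑ ^ p ≤
      ∫⁻ t in Set.Icc (0 : ℝ) 1, ‖derivWithin φ (Set.Icc 0 1) t‖ₑ ^ p := by
  have hp0 : 0 < p := by linarith
  by_cases h : ∃ t ∈ Set.Icc (0 : ℝ) 1, φ t ≠ 0
  · have hle : poincareConst p ≤ _ := iInf₂_le φ ⟨h1, h0, h01, h⟩
    have hp1 : ENNReal.ofReal p ≠ 0 := by simpa using hp0
    rw [eLpNorm_eq_lintegral_rpow_enorm_toReal hp1 ENNReal.ofReal_ne_top,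
      eLpNorm_eq_lintegral_rpow_enorm_toReal hp1 ENNReal.ofReal_ne_top,
      ENNReal.toReal_ofReal hp0.le] at hle
    have := ENNReal.mul_le_of_le_div hle
    have := ENNReal.rpow_le_rpow this hp0.le
    rwa [ENNReal.mul_rpow_of_nonneg _ _ hp0.le, ← ENNReal.rpow_mul, ← ENNReal.rpow_mul,
      one_div_mul_cancel hp0.ne', ENNReal.rpow_one, ENNReal.rpow_one] at this
  · push Not at h
    rw [setLIntegral_congr_fun (g := fun _ => 0) measurableSet_Icc
      (fun t ht => by simp [h t ht, hp0])]
    simp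

/-- The primitive of a continuous function of mean zero vanishes at both ends. In this form a
competitor is built by prescribing its derivative. -/
theorem poincareConst_rpow_mul_le_of_integral_eq_zero {p : ℝ} (hp : 1 < p) {h : ℝ → ℝ}
    (hc : Continuous h) (h0 : ∫ s in (0 : ℝ)..1, h s = 0) :
    poincareConst p ^ p * ∫⁻ t in Set.Icc (0 : ℝ) 1, ‖∫ s in (0 : ℝ)..t, h s‖ₑ ^ p ≤
      ∫⁻ t in Set.Icc (0 : ℝ) 1, ‖h t‖ₑ ^ p := by
  have hd : ∀ t, HasDerivAt (fun t => ∫ s in (0 : ℝ)..t, h s) (h t) t := fun t =>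
    hc.integral_hasStrictDerivAt 0 t |>.hasDerivAt
  have hC : ContDiff ℝ 1 (fun t => ∫ s in (0 : ℝ)..t, h s) := by
    rw [contDiff_one_iff_deriv]
    exact ⟨fun t => (hd t).differentiableAt, by simpa only [funext fun t => (hd t).deriv] using hc⟩
  refine (poincareConst_rpow_mul_le hp hC.contDiffOn (by simp) h0).trans_eq ?_
  refine setLIntegral_congr_fun measurableSet_Icc fun t ht => ?_
  rw [(hd t).hasDerivWithinAt.derivWithin (uniqueDiffOn_Icc zero_lt_one t ht)]

/-- Even reflection of `f` about `1/2` would give a function vanishing at `0` and `1`, with both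
integrals doubled, but it is not `C^1` unless `f'(1/2) = 0`. So `f'` is first cut off continuously
to `0` at `1/2` and then extended oddly; the primitive agrees with `f` up to `1/2 - 1/(n+1)`, and
monotone convergence removes the cutoff. -/
theorem poincareConst_rpow_mul_le_half {p : ℝ} (hp : 1 < p) {f : ℝ → ℝ} (hf : ContDiff ℝ 1 f)
    (h0 : f 0 = 0) :
    poincareConst p ^ p * ∫⁻ t in Set.Icc (0 : ℝ) (1 / 2), ‖f t‖ₑ ^ p ≤
      ∫⁻ t in Set.Icc (0 : ℝ) (1 / 2), ‖deriv f t‖ₑ ^ p := by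
  have hp0 : 0 < p := by linarith
  have hf' : Continuous (deriv f) := hf.continuous_deriv le_rfl
  have key : ∀ n : ℕ, poincareConst p ^ p *
      ∫⁻ t in Set.Icc (0 : ℝ) (1 / 2 - 1 / (n + 1)), ‖f t‖ₑ ^ p ≤
      ∫⁻ t in Set.Icc (0 : ℝ) (1 / 2), ‖deriv f t‖ₑ ^ p := by
    intro n
    set χ : ℝ → ℝ := fun t => max 0 (min 1 ((n + 1) * (1 / 2 - t))) with hχ
    have hχ0 : ∀ t, 0 ≤ χ t := fun t => le_max_left _ _
    have hχ1 : ∀ t, χ t ≤ 1 := fun t => max_le zero_le_one (min_le_left _ _)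
    have hχz : ∀ t, 1 / 2 ≤ t → χ t = 0 := fun t ht => max_eq_left <| (min_le_right _ _).trans <|
      mul_nonpos_of_nonneg_of_nonpos (by positivity) (by linarith)
    have hχe : ∀ t, t ≤ 1 / 2 - 1 / ((n : ℝ) + 1) → χ t = 1 := fun t ht => by
      have : 1 ≤ ((n : ℝ) + 1) * (1 / 2 - t) := by
        rw [← div_le_iff₀' (by positivity)]; linarith
      rw [hχ]
      beta_reduce
      rw [min_eq_left this, max_eq_right zero_le_one]
    set h : ℝ → ℝ := fun t => deriv f t * χ t with hh
    have hhc : Continuous h := by fun_prop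
    set H : ℝ → ℝ := fun t => h t - h (1 - t) with hH
    have hHc : Continuous H := by fun_prop
    have hHs : ∀ t, H (1 - t) = - H t := fun t => by simp [hH]
    have hHh : ∀ t, t ≤ 1 / 2 → H t = h t := fun t ht => by
      simp [hH, hh, hχz (1 - t) (by linarith)]
    have hi : ∫ s in (0 : ℝ)..1, H s = 0 := by
      have := intervalIntegral.integral_comp_sub_left (a := 0) (b := 1) H 1
      simp only [hHs, intervalIntegral.integral_neg, sub_self, sub_zero] at this
      linarith
    have hsym : ∀ t, ∫ s in (0 : ℝ)..(1 - t), H s = ∫ s in (0 : ℝ)..t, H s := fun t => by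
      have := intervalIntegral.integral_comp_sub_left (a := 0) (b := t) H 1
      simp only [hHs, intervalIntegral.integral_neg, sub_zero] at this
      have h2 := intervalIntegral.integral_add_adjacent_intervals
        (hHc.intervalIntegrable (μ := volume) 0 (1 - t)) (hHc.intervalIntegrable (1 - t) 1)
      linarith
    have hP := poincareConst_rpow_mul_le_of_integral_eq_zero hp hHc hi
    rw [setLIntegral_Icc_zero_one_of_symm (fun t => by rw [hsym]),
      setLIntegral_Icc_zero_one_of_symm (fun t => by rw [hHs, enorm_neg]), mul_left_comm,
      ENNReal.mul_le_mul_iff_right (by simp) (by simp)] at hP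
    calc _ ≤ poincareConst p ^ p *
          ∫⁻ t in Set.Icc (0 : ℝ) (1 / 2), ‖∫ s in (0 : ℝ)..t, H s‖ₑ ^ p := by
          refine mul_le_mul_right ?_ _
          have hsub : Set.Icc (0 : ℝ) (1 / 2 - 1 / (n + 1)) ⊆ Set.Icc 0 (1 / 2) :=
            Set.Icc_subset_Icc_right (by linarith [show 0 < 1 / ((n : ℝ) + 1) by positivity])
          refine le_trans (le_of_eq ?_) (lintegral_mono_set (μ := volume) hsub)
          refine setLIntegral_congr_fun measurableSet_Icc fun t ht => ?_
          have : ∫ s in (0 : ℝ)..t, H s = f t := by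
            rw [intervalIntegral.integral_congr (g := deriv f),
              intervalIntegral.integral_deriv_eq_sub, h0, sub_zero]
            · exact fun x _ => hf.differentiable one_ne_zero x
            · exact hf'.intervalIntegrable _ _
            · intro s hs
              rw [Set.uIcc_of_le ht.1] at hs
              have : s ≤ 1 / 2 - 1 / (n + 1) := hs.2.trans ht.2
              rw [hHh s (this.trans (by linarith [show 0 < 1 / ((n : ℝ) + 1) by positivity])), hh]
              simp [hχe s this]
          simp only [this]
      _ ≤ ∫⁻ t in Set.Icc (0 : ℝ) (1 / 2), ‖H t‖ₑ ^ p := hP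
      _ ≤ _ := by
          refine setLIntegral_mono' measurableSet_Icc fun t ht => ?_
          gcongr
          rw [hHh t ht.2, hh, enorm_mul]
          refine mul_le_of_le_one_right' ?_
          rw [Real.enorm_of_nonneg (hχ0 t)]
          exact ENNReal.ofReal_le_one.2 (hχ1 t)
  have hU : ⋃ n : ℕ, Set.Icc (0 : ℝ) (1 / 2 - 1 / (n + 1)) = Set.Ico 0 (1 / 2) := by
    ext t
    simp only [Set.mem_iUnion, Set.mem_Icc, Set.mem_Ico]
    constructor
    · rintro ⟨n, h1, h2⟩
      exact ⟨h1, h2.trans_lt (by linarith [show 0 < 1 / ((n : ℝ) + 1) by positivity])⟩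
    · rintro ⟨h1, h2⟩
      obtain ⟨n, hn⟩ := exists_nat_one_div_lt (sub_pos.2 h2)
      exact ⟨n, h1, by linarith⟩
  have hmono : Monotone fun n : ℕ => Set.Icc (0 : ℝ) (1 / 2 - 1 / (n + 1)) := fun m n hmn =>
    Set.Icc_subset_Icc_right (sub_le_sub_left (Nat.one_div_le_one_div hmn) _)
  have hlim : ∫⁻ t in Set.Icc (0 : ℝ) (1 / 2), ‖f t‖ₑ ^ p =
      ⨆ n : ℕ, ∫⁻ t in Set.Icc (0 : ℝ) (1 / 2 - 1 / (n + 1)), ‖f t‖ₑ ^ p := by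
    rw [← restrict_Ico_eq_restrict_Icc, ← hU]
    exact setLIntegral_iUnion_of_directed _ hmono.directed_le
  rw [hlim, ENNReal.mul_iSup]
  exact iSup_le key

theorem setLIntegral_comp_mul_left {c : ℝ} (hc : 0 < c) (F : ℝ → ℝ≥0∞) (a b : ℝ) :
    ∫⁻ t in Set.Icc a b, F (c * t) =
      (ENNReal.ofReal c)⁻¹ * ∫⁻ t in Set.Icc (c * a) (c * b), F t := by
  rw [← lintegral_indicator measurableSet_Icc, ← lintegral_indicator measurableSet_Icc,
    ← ENNReal.ofReal_inv_of_pos hc]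
  have := lintegral_comp_smul_addHaar volume ((Set.Icc (c * a) (c * b)).indicator F) hc.ne'
  simp only [Module.finrank_self, pow_one, smul_eq_mul, abs_of_pos (inv_pos.2 hc)] at this
  rw [← this]
  refine lintegral_congr fun t => ?_
  simp only [Set.indicator_apply, Set.mem_Icc, mul_le_mul_iff_right₀ hc]

/-- The Poincaré inequality on `[0, l]` for functions vanishing at `0` only. -/
theorem poincareConst_rpow_mul_le_Icc {p : ℝ} (hp : 1 < p) {f : ℝ → ℝ} (hf : ContDiff ℝ 1 f)
    (h0 : f 0 = 0) {l : ℝ} (hl : 0 < l) :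
    (poincareConst p / ENNReal.ofReal (2 * l)) ^ p * ∫⁻ t in Set.Icc 0 l, ‖f t‖ₑ ^ p ≤
      ∫⁻ t in Set.Icc 0 l, ‖deriv f t‖ₑ ^ p := by
  have hp0 : 0 < p := by linarith
  have hc : 0 < 2 * l := by linarith
  have hcl : 2 * l * (1 / 2) = l := by ring
  have h := poincareConst_rpow_mul_le_half hp (f := fun t => f (2 * l * t)) (by fun_prop)
    (by simpa using h0)
  have hd : ∀ t, ‖deriv (fun t => f (2 * l * t)) t‖ₑ ^ p =
      ENNReal.ofReal (2 * l) ^ p * ‖deriv f (2 * l * t)‖ₑ ^ p := fun t => by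
    rw [← ENNReal.mul_rpow_of_nonneg _ _ hp0.le, ← Real.enorm_of_nonneg hc.le, ← enorm_mul]
    congr 2
    simpa using deriv_comp_mul_left (2 * l) f t
  simp only [hd] at h
  have hcp : ENNReal.ofReal (2 * l) ^ p ≠ ⊤ :=
    ENNReal.rpow_ne_top_of_nonneg hp0.le ENNReal.ofReal_ne_top
  rw [setLIntegral_comp_mul_left hc (fun t => ‖f t‖ₑ ^ p), lintegral_const_mul' _ _ hcp,
    setLIntegral_comp_mul_left hc (fun t => ‖deriv f t‖ₑ ^ p), mul_zero, hcl,
    mul_left_comm, mul_left_comm (ENNReal.ofReal (2 * l) ^ p),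
    ENNReal.mul_le_mul_iff_right (ENNReal.inv_ne_zero.2 ENNReal.ofReal_ne_top)
      (by simpa using hl)] at h
  rw [ENNReal.div_rpow_of_nonneg _ _ hp0.le, ← ENNReal.mul_div_right_comm]
  exact ENNReal.div_le_of_le_mul' h

/-- Such an `S` is, up to its right endpoint, an interval `[0, l)` with `l ≤ R`, and the constant
for length `l` is at least the one for `R`. -/
theorem poincareConst_rpow_mul_le_of_isLowerSet {p : ℝ} (hp : 1 < p) {f : ℝ → ℝ}
    (hf : ContDiff ℝ 1 f) (h0 : f 0 = 0) {S : Set ℝ} {R : ℝ} (hS : S ⊆ Set.Icc 0 R)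
    (hS' : ∀ t ∈ S, ∀ s, 0 ≤ s → s ≤ t → s ∈ S) :
    (poincareConst p / ENNReal.ofReal (2 * R)) ^ p * ∫⁻ t in S, ‖f t‖ₑ ^ p ≤
      ∫⁻ t in S, ‖deriv f t‖ₑ ^ p := by
  have hp0 : 0 < p := by linarith
  rcases S.eq_empty_or_nonempty with rfl | hne
  · simp
  have hb : BddAbove S := ⟨R, fun t ht => (hS ht).2⟩
  set l := sSup S
  have hSl : S ⊆ Set.Icc 0 l := fun t ht => ⟨(hS ht).1, le_csSup hb ht⟩
  have hlS : Set.Ico 0 l ⊆ S := fun s hs => by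
    obtain ⟨t, ht, hst⟩ := exists_lt_of_lt_csSup hne hs.2
    exact hS' t ht s hs.1 hst.le
  have hlR : l ≤ R := csSup_le hne fun t ht => (hS ht).2
  obtain ⟨t, ht⟩ := hne
  rcases ((hSl ht).1.trans (hSl ht).2).eq_or_lt with hl0 | hl
  · have : ∫⁻ t in S, ‖f t‖ₑ ^ p = 0 := by
      refine le_antisymm ((lintegral_mono_set hSl).trans ?_) zero_le
      simp [← hl0]
    simp [this]
  calc _ ≤ (poincareConst p / ENNReal.ofReal (2 * l)) ^ p * ∫⁻ t in Set.Icc 0 l, ‖f t‖ₑ ^ p := by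
        refine mul_le_mul' ?_ (lintegral_mono_set hSl)
        gcongr
    _ ≤ ∫⁻ t in Set.Icc 0 l, ‖deriv f t‖ₑ ^ p := poincareConst_rpow_mul_le_Icc hp hf h0 hl
    _ ≤ _ := by
        rw [← restrict_Ico_eq_restrict_Icc]
        exact lintegral_mono_set hlS

/-! ### Smooth almost-minimizers of the one-dimensional Rayleigh quotient -/

/-- Weierstrass polynomials times smooth cutoffs that exhaust `(0, 1)`. As `h` need not vanish at
the ends, convergence cannot be uniform; bounded pointwise convergence is enough for dominated
convergence. -/
theorem exists_contDiff_seq_tendsto {h : ℝ → ℝ} (hh : ContinuousOn h (Set.Icc 0 1)) :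
    ∃ (w : ℕ → ℝ → ℝ) (M : ℝ), (∀ n, ContDiff ℝ ∞ (w n)) ∧
      (∀ n, ∃ δ > 0, ∀ t, w n t ≠ 0 → t ∈ Set.Icc δ (1 - δ)) ∧ (∀ n t, |w n t| ≤ M) ∧
      ∀ t ∈ Set.Ioo (0 : ℝ) 1, Tendsto (fun n => w n t) atTop (𝓝 (h t)) := by
  have hε : ∀ n : ℕ, 0 < 1 / ((n : ℝ) + 1) := fun n => by positivity
  choose q hq using fun n : ℕ => exists_polynomial_near_of_continuousOn 0 1 h hh _ (hε n)
  obtain ⟨M, hM⟩ := isCompact_Icc.exists_bound_of_continuousOn hh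
  set χ : ℕ → ℝ → ℝ := fun n t => Real.smoothTransition ((n + 1) * t - 1) *
    Real.smoothTransition ((n + 1) * (1 - t) - 1) with hχ
  have hχ0 : ∀ n t, 0 ≤ χ n t := fun n t =>
    mul_nonneg (Real.smoothTransition.nonneg _) (Real.smoothTransition.nonneg _)
  have hχ1 : ∀ n t, χ n t ≤ 1 := fun n t => mul_le_one₀ (Real.smoothTransition.le_one _)
    (Real.smoothTransition.nonneg _) (Real.smoothTransition.le_one _)
  have hχs : ∀ n t, χ n t ≠ 0 → t ∈ Set.Icc (1 / ((n : ℝ) + 1)) (1 - 1 / (n + 1)) := by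
    intro n t ht
    have h1 : 0 < (n + 1) * t - 1 := by
      by_contra hcon
      exact ht (by simp [hχ, Real.smoothTransition.zero_of_nonpos (not_lt.1 hcon)])
    have h2 : 0 < (n + 1) * (1 - t) - 1 := by
      by_contra hcon
      exact ht (by simp [hχ, Real.smoothTransition.zero_of_nonpos (not_lt.1 hcon)])
    have hn : (0 : ℝ) < n + 1 := by positivity
    constructor
    · rw [div_le_iff₀' hn]; linarith
    · rw [le_sub_comm, div_le_iff₀' hn]; linarith
  refine ⟨fun n t => (q n).eval t * χ n t, M + 1, fun n => ?_, fun n => ⟨_, hε n, fun t ht =>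
    hχs n t (right_ne_zero_of_mul ht)⟩, fun n t => ?_, fun t ht => ?_⟩
  · have := Real.smoothTransition.contDiff (n := ⊤)
    exact ((q n).contDiff_aeval _).mul ((this.comp (by fun_prop)).mul (this.comp (by fun_prop)))
  · by_cases hz : χ n t = 0
    · have := (norm_nonneg _).trans (hM 0 (by simp))
      simp only [hz, mul_zero, abs_zero]; linarith
    · have ht := hχs n t hz
      have ht' : t ∈ Set.Icc (0 : ℝ) 1 := ⟨(hε n).le.trans ht.1, by linarith [ht.2, hε n]⟩
      have h1 := hq n t ht'
      have h2 := hM t ht'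
      have h3 : 1 / ((n : ℝ) + 1) ≤ 1 := by
        rw [div_le_one (by positivity)]; linarith [Nat.cast_nonneg (α := ℝ) n]
      rw [abs_mul, abs_of_nonneg (hχ0 n t)]
      refine (mul_le_of_le_one_right (abs_nonneg _) (hχ1 n t)).trans ?_
      rw [Real.norm_eq_abs] at h2
      have := abs_sub_abs_le_abs_sub ((q n).eval t) (h t)
      linarith
  · have h1 : Tendsto (fun n : ℕ => (q n).eval t) atTop (𝓝 (h t)) := by
      rw [tendsto_iff_dist_tendsto_zero]
      exact squeeze_zero (fun _ => dist_nonneg) (fun n => (hq n t ⟨ht.1.le, ht.2.le⟩).le)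
        tendsto_one_div_add_atTop_nhds_zero_nat
    have h2 : ∀ᶠ n : ℕ in atTop, χ n t = 1 := by
      have hlim : ∀ s : ℝ, 0 < s → ∀ᶠ n : ℕ in atTop, 1 ≤ ((n : ℝ) + 1) * s - 1 := fun s hs => by
        have : Tendsto (fun n : ℕ => ((n : ℝ) + 1) * s - 1) atTop atTop :=
          tendsto_atTop_add_const_right _ _
            ((tendsto_natCast_atTop_atTop.atTop_add tendsto_const_nhds).atTop_mul_const hs)
        exact this.eventually_ge_atTop 1
      filter_upwards [hlim t ht.1, hlim (1 - t) (by linarith [ht.2])] with n hn hn'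
      simp only [hχ]
      rw [Real.smoothTransition.one_of_one_le hn, Real.smoothTransition.one_of_one_le hn', mul_one]
    have := h1.mul (tendsto_const_nhds.congr' (h2.mono fun _ h => h.symm))
    simpa using this

theorem contDiff_primitive {g : ℝ → ℝ} (hg : ContDiff ℝ ∞ g) :
    ContDiff ℝ ∞ (fun t => ∫ s in (0 : ℝ)..t, g s) := by
  have hd : ∀ t, HasDerivAt (fun t => ∫ s in (0 : ℝ)..t, g s) (g t) t := fun t =>
    hg.continuous.integral_hasStrictDerivAt 0 t |>.hasDerivAt
  rw [contDiff_infty_iff_deriv, funext fun t => (hd t).deriv]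
  exact ⟨fun t => (hd t).differentiableAt, hg⟩

theorem primitive_ne_zero_mem_Icc {g : ℝ → ℝ} (hg : Continuous g) {δ : ℝ}
    (hs : ∀ t, g t ≠ 0 → t ∈ Set.Icc δ (1 - δ)) (h0 : ∫ s in (0 : ℝ)..1, g s = 0) (hδ : 0 < δ)
    {t : ℝ} (ht : ∫ s in (0 : ℝ)..t, g s ≠ 0) : t ∈ Set.Icc δ (1 - δ) := by
  by_contra hcon
  apply ht
  rw [Set.mem_Icc, not_and_or, not_le, not_le] at hcon
  rcases hcon with h | h
  · refine intervalIntegral.integral_zero_ae (ae_of_all _ fun s hs' => ?_)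
    by_contra hne
    have h1 := (hs s hne).1
    rcases Set.mem_uIoc.1 hs' with h2 | h2 <;> linarith [h2.2]
  · have : ∫ s in t..1, g s = 0 := by
      refine intervalIntegral.integral_zero_ae (ae_of_all _ fun s hs' => ?_)
      by_contra hne
      have h1 := (hs s hne).2
      rcases Set.mem_uIoc.1 hs' with h2 | h2 <;> linarith [h2.1]
    have h2 := intervalIntegral.integral_add_adjacent_intervals
      (hg.intervalIntegrable (μ := volume) 0 t) (hg.intervalIntegrable t 1)
    linarith

theorem tendsto_primitive {w : ℕ → ℝ → ℝ} {h : ℝ → ℝ} {M : ℝ} (hw : ∀ n, Continuous (w n))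
    (hM : ∀ n t, |w n t| ≤ M)
    (hlim : ∀ t ∈ Set.Ioo (0 : ℝ) 1, Tendsto (fun n => w n t) atTop (𝓝 (h t)))
    {t : ℝ} (ht : t ∈ Set.Icc (0 : ℝ) 1) :
    Tendsto (fun n => ∫ s in (0 : ℝ)..t, w n s) atTop (𝓝 (∫ s in (0 : ℝ)..t, h s)) := by
  refine intervalIntegral.tendsto_integral_filter_of_dominated_convergence (fun _ => M)
    (Eventually.of_forall fun n => (hw n).aestronglyMeasurable)
    (Eventually.of_forall fun n => ae_of_all _ fun s _ => hM n s) intervalIntegrable_const ?_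
  filter_upwards [Measure.ae_ne volume (1 : ℝ)] with s hs1 hs
  rw [Set.uIoc_of_le ht.1] at hs
  -- Convergence is known on the open interval only, hence the exclusion of the null set `{1}`.
  exact hlim s ⟨hs.1, lt_of_le_of_ne (hs.2.trans ht.2) hs1⟩

theorem tendsto_setLIntegral_rpow_enorm {p : ℝ} (hp : 0 < p) {w : ℕ → ℝ → ℝ} {h : ℝ → ℝ} {M : ℝ}
    (hw : ∀ n, Continuous (w n)) (hM : ∀ n, ∀ t ∈ Set.Icc (0 : ℝ) 1, |w n t| ≤ M)
    (hlim : ∀ t ∈ Set.Ioo (0 : ℝ) 1, Tendsto (fun n => w n t) atTop (𝓝 (h t))) :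
    Tendsto (fun n => ∫⁻ t in Set.Icc (0 : ℝ) 1, ‖w n t‖ₑ ^ p) atTop
      (𝓝 (∫⁻ t in Set.Icc (0 : ℝ) 1, ‖h t‖ₑ ^ p)) := by
  refine tendsto_lintegral_of_dominated_convergence (fun _ => ENNReal.ofReal M ^ p)
    (fun n => ((hw n).measurable.enorm).pow_const p) (fun n => ?_) ?_ ?_
  · filter_upwards [ae_restrict_mem measurableSet_Icc] with t ht
    gcongr
    rw [← ofReal_norm]
    exact ENNReal.ofReal_le_ofReal (hM n t ht)
  · simp [ENNReal.rpow_ne_top_of_nonneg hp.le]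
  · rw [← restrict_Ioo_eq_restrict_Icc]
    filter_upwards [ae_restrict_mem measurableSet_Ioo] with t ht
    exact ((hlim t ht).enorm).ennrpow_const p

/-- The infimum defining `poincareConst` can be approached by smooth functions compactly supported
in `(0, 1)`. -/
theorem exists_contDiff_rayleigh_le {p : ℝ} (hp : 1 < p) {q : ℝ≥0∞} (hq : poincareConst p < q) :
    ∃ φ : ℝ → ℝ, ContDiff ℝ ∞ φ ∧ (∃ δ > 0, ∀ t, φ t ≠ 0 → t ∈ Set.Icc δ (1 - δ)) ∧
      ∫⁻ t, ‖φ t‖ₑ ^ p ≠ 0 ∧ ∫⁻ t, ‖deriv φ t‖ₑ ^ p ≤ q ^ p * ∫⁻ t, ‖φ t‖ₑ ^ p := by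
  have hp0 : 0 < p := by linarith
  have hp1 : ENNReal.ofReal p ≠ 0 := by simpa using hp0
  obtain ⟨φ, hφ⟩ := iInf_lt_iff.1 hq
  obtain ⟨⟨hC, h0, h1, τ, hτ, hφτ⟩, hφ⟩ := iInf_lt_iff.1 hφ
  set h := derivWithin φ (Set.Icc 0 1) with hh
  have hhc : ContinuousOn h (Set.Icc 0 1) :=
    hC.continuousOn_derivWithin (uniqueDiffOn_Icc zero_lt_one) le_rfl
  have hFTC : ∀ t ∈ Set.Icc (0 : ℝ) 1, ∫ s in (0 : ℝ)..t, h s = φ t := by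
    intro t ht
    have hsub : Set.Icc 0 t ⊆ Set.Icc (0 : ℝ) 1 := Set.Icc_subset_Icc_right ht.2
    rw [intervalIntegral.integral_eq_sub_of_hasDerivAt_of_le ht.1 (hC.continuousOn.mono hsub), h0,
      sub_zero]
    · intro s hs
      have hs' : Set.Icc (0 : ℝ) 1 ∈ 𝓝 s := Icc_mem_nhds hs.1 (hs.2.trans_le ht.2)
      exact ((hC.differentiableOn one_ne_zero s
        (mem_of_mem_nhds hs')).hasDerivWithinAt).hasDerivAt hs'
    · exact ((hhc.mono hsub).intervalIntegrable_of_Icc ht.1)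
  have hne : ∫⁻ t in Set.Icc (0 : ℝ) 1, ‖φ t‖ₑ ^ p ≠ 0 := by
    intro hz
    rw [lintegral_eq_zero_iff' ((hC.continuousOn.aemeasurable measurableSet_Icc).enorm.pow_const p)]
      at hz
    have hz' : φ =ᵐ[volume.restrict (Set.Icc 0 1)] fun _ => 0 := by
      filter_upwards [hz] with t ht
      simpa [hp0, hp0.not_gt] using ht
    exact hφτ (Measure.eqOn_Icc_of_ae_eq volume zero_ne_one hz' hC.continuousOn
      continuousOn_const hτ)
  have hlt : ∫⁻ t in Set.Icc (0 : ℝ) 1, ‖h t‖ₑ ^ p <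
      q ^ p * ∫⁻ t in Set.Icc (0 : ℝ) 1, ‖φ t‖ₑ ^ p := by
    have hft : ∫⁻ t in Set.Icc (0 : ℝ) 1, ‖φ t‖ₑ ^ p ≠ ⊤ := by
      obtain ⟨M, hM⟩ := isCompact_Icc.exists_bound_of_continuousOn hC.continuousOn
      refine ((setLIntegral_mono' (g := fun _ => ENNReal.ofReal M ^ p) measurableSet_Icc
        fun t ht => ?_).trans_lt ?_).ne
      · gcongr
        rw [← ofReal_norm]
        exact ENNReal.ofReal_le_ofReal (hM t ht)
      · simp [ENNReal.rpow_lt_top_of_nonneg hp0.le]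
    rw [eLpNorm_eq_lintegral_rpow_enorm_toReal hp1 ENNReal.ofReal_ne_top,
      eLpNorm_eq_lintegral_rpow_enorm_toReal hp1 ENNReal.ofReal_ne_top,
      ENNReal.toReal_ofReal hp0.le, ENNReal.div_lt_iff (by simp [hne, hp0, hp0.le, hft])
        (by simp [hft, hp0, hp0.le, hne])] at hφ
    have := ENNReal.rpow_lt_rpow hφ hp0
    rwa [ENNReal.mul_rpow_of_nonneg _ _ hp0.le, ← ENNReal.rpow_mul, ← ENNReal.rpow_mul,
      one_div_mul_cancel hp0.ne', ENNReal.rpow_one, ENNReal.rpow_one] at this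
  -- The derivative `h`, not `φ`, is approximated; the smooth competitors are then primitives.
  obtain ⟨w, M, hwC, hws, hwM, hwlim⟩ := exists_contDiff_seq_tendsto hhc
  have hM0 : 0 ≤ M := (abs_nonneg _).trans (hwM 0 0)
  -- A bump of integral `1` supported well inside `(0, 1)`. Subtracting `m n` times it makes the
  -- mean of `w n` zero, so that the primitive vanishes near both ends. The correction disappears in
  -- the limit because `m n → ∫ h = φ 1 = 0`.
  set β : ContDiffBump (1 / 2 : ℝ) := ⟨1 / 8, 1 / 4, by norm_num, by norm_num⟩
  set b : ℝ → ℝ := β.normed volume with hb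
  have hbC : ContDiff ℝ ∞ b := β.contDiff_normed
  have hbs : ∀ t, b t ≠ 0 → t ∈ Set.Icc (1 / 4 : ℝ) (1 - 1 / 4) := by
    intro t ht
    have : t ∈ Function.support b := ht
    rw [hb, β.support_normed_eq, Real.ball_eq_Ioo] at this
    have h3 := this.1
    have h4 := this.2
    norm_num [β] at h3 h4 ⊢
    constructor <;> linarith
  have hbi : ∫ s in (0 : ℝ)..1, b s = 1 := by
    rw [intervalIntegral.integral_eq_integral_of_support_subset, β.integral_normed]
    intro t ht
    have := hbs t ht
    constructor <;> linarith [this.1, this.2]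
  obtain ⟨B, hB⟩ : ∃ B, ∀ t, ‖b t‖ ≤ B :=
    hbC.continuous.bounded_above_of_compact_support β.hasCompactSupport_normed
  have hB0 : 0 ≤ B := (norm_nonneg _).trans (hB 0)
  set m : ℕ → ℝ := fun n => ∫ s in (0 : ℝ)..1, w n s with hm
  have hm0 : Tendsto m atTop (𝓝 0) := by
    have := tendsto_primitive (fun n => (hwC n).continuous) hwM hwlim (t := 1) (by simp)
    rwa [hFTC 1 (by simp), h1] at this
  have hmM : ∀ n, |m n| ≤ M := fun n => by
    have := intervalIntegral.norm_integral_le_of_norm_le_const (a := 0) (b := 1) (f := w n)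
      fun s _ => hwM n s
    simpa using this
  set g : ℕ → ℝ → ℝ := fun n t => w n t - m n * b t with hg
  have hgC : ∀ n, ContDiff ℝ ∞ (g n) := fun n => (hwC n).sub (contDiff_const.mul hbC)
  have hgM : ∀ n t, |g n t| ≤ M + M * B := fun n t => by
    refine (abs_sub _ _).trans (add_le_add (hwM n t) ?_)
    rw [abs_mul]
    exact mul_le_mul (hmM n) (hB t) (abs_nonneg _) hM0
  have hgs : ∀ n, ∃ δ > 0, ∀ t, g n t ≠ 0 → t ∈ Set.Icc δ (1 - δ) := fun n => by
    obtain ⟨δ, hδ, hδs⟩ := hws n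
    refine ⟨min δ (1 / 4), lt_min hδ (by norm_num), fun t ht => ?_⟩
    have h3 := min_le_left δ (1 / 4)
    have h4 := min_le_right δ (1 / 4)
    by_cases hz : w n t = 0
    · have hz' : b t ≠ 0 := fun hz' => ht (by simp [hg, hz, hz'])
      have := hbs t hz'
      constructor <;> linarith [this.1, this.2]
    · have := hδs t hz
      constructor <;> linarith [this.1, this.2]
  have hgi : ∀ n, ∫ s in (0 : ℝ)..1, g n s = 0 := fun n => by
    have hI : IntervalIntegrable (fun s => m n * b s) volume 0 1 :=
      (continuous_const.mul hbC.continuous).intervalIntegrable _ _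
    rw [intervalIntegral.integral_sub ((hwC n).continuous.intervalIntegrable _ _) hI,
      intervalIntegral.integral_const_mul, hbi, mul_one, sub_self]
  have hglim : ∀ t ∈ Set.Ioo (0 : ℝ) 1, Tendsto (fun n => g n t) atTop (𝓝 (h t)) := fun t ht => by
    simpa using (hwlim t ht).sub (hm0.mul_const (b t))
  set u : ℕ → ℝ → ℝ := fun n t => ∫ s in (0 : ℝ)..t, g n s with hu
  have huC : ∀ n, ContDiff ℝ ∞ (u n) := fun n => contDiff_primitive (hgC n)
  have hud : ∀ n, deriv (u n) = g n := fun n =>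
    funext fun t => (hgC n).continuous.deriv_integral _ _ _
  have hus : ∀ n, ∃ δ > 0, ∀ t, u n t ≠ 0 → t ∈ Set.Icc δ (1 - δ) := fun n => by
    obtain ⟨δ, hδ, hδs⟩ := hgs n
    exact ⟨δ, hδ, fun t => primitive_ne_zero_mem_Icc (hgC n).continuous hδs (hgi n) hδ⟩
  have huM : ∀ n, ∀ t ∈ Set.Icc (0 : ℝ) 1, |u n t| ≤ M + M * B := fun n t ht => by
    have := intervalIntegral.norm_integral_le_of_norm_le_const (a := 0) (b := t) (f := g n)
      fun s _ => hgM n s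
    rw [sub_zero, abs_of_nonneg ht.1] at this
    exact this.trans (mul_le_of_le_one_right (by positivity) ht.2)
  have hulim : ∀ t ∈ Set.Ioo (0 : ℝ) 1, Tendsto (fun n => u n t) atTop (𝓝 (φ t)) := fun t ht => by
    have := tendsto_primitive (fun n => (hgC n).continuous) hgM hglim (t := t) ⟨ht.1.le, ht.2.le⟩
    rwa [hFTC t ⟨ht.1.le, ht.2.le⟩] at this
  have hT1 := tendsto_setLIntegral_rpow_enorm hp0 (fun n => (hgC n).continuous)
    (fun n t _ => hgM n t) hglim
  have hT2 := ENNReal.Tendsto.const_mul (a := q ^ p) (tendsto_setLIntegral_rpow_enorm hp0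
    (fun n => (huC n).continuous) huM hulim) (Or.inl hne)
  -- The inequality is strict in the limit, hence holds for some `n`; its strictness also shows that
  -- `u n` is not almost everywhere zero.
  obtain ⟨n, hn⟩ := (hT1.eventually_lt hT2 hlt).exists
  have hfull : ∀ f : ℝ → ℝ, (∃ δ > 0, ∀ t, f t ≠ 0 → t ∈ Set.Icc δ (1 - δ)) →
      ∫⁻ t in Set.Icc (0 : ℝ) 1, ‖f t‖ₑ ^ p = ∫⁻ t, ‖f t‖ₑ ^ p := by
    rintro f ⟨δ, hδ, hs⟩
    refine setLIntegral_eq_of_support_subset fun t ht => ?_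
    have := hs t (fun hz => ht (by simp [hz, hp0]))
    exact ⟨by linarith [this.1], by linarith [this.2]⟩
  rw [hfull _ (hgs n), hfull _ (hus n)] at hn
  refine ⟨u n, huC n, hus n, fun hz => ?_, ?_⟩
  · simp [hz] at hn
  · rw [hud]; exact hn.le

/-! ### Test functions -/

theorem enorm_gradient {E : Type*} [NormedAddCommGroup E] [InnerProductSpace ℝ E] [CompleteSpace E]
    (u : E → ℝ) (x : E) : ‖gradient u x‖ₑ = ‖fderiv ℝ u x‖ₑ := by
  rw [gradient, ← ofReal_norm, LinearIsometryEquiv.norm_map, ofReal_norm]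

section TestFunction

variable {N : ℕ} {Ω : Set (EuclideanSpace ℝ (Fin N))} {u : EuclideanSpace ℝ (Fin N) → ℝ}

theorem IsTestFunction.eq_zero (hu : IsTestFunction Ω u) {x : EuclideanSpace ℝ (Fin N)}
    (hx : x ∉ Ω) : u x = 0 :=
  image_eq_zero_of_notMem_tsupport fun h => hx (hu.2.2.1 h)

theorem IsTestFunction.setLIntegral_eq (hu : IsTestFunction Ω u) {p : ℝ} (hp : 0 < p) :
    ∫⁻ x in Ω, ‖u x‖ₑ ^ p = ∫⁻ x, ‖u x‖ₑ ^ p := by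
  refine setLIntegral_eq_of_support_subset fun x hx => ?_
  by_contra h
  exact hx (by simp [hu.eq_zero h, hp])

theorem IsTestFunction.setLIntegral_gradient_eq (hu : IsTestFunction Ω u) {p : ℝ} (hp : 0 < p) :
    ∫⁻ x in Ω, ‖gradient u x‖ₑ ^ p = ∫⁻ x, ‖fderiv ℝ u x‖ₑ ^ p := by
  simp only [enorm_gradient]
  refine setLIntegral_eq_of_support_subset fun x hx => ?_
  by_contra h
  refine hx ?_
  have : fderiv ℝ u x = 0 := image_eq_zero_of_notMem_tsupport fun hx =>
    h (hu.2.2.1 (tsupport_fderiv_subset ℝ hx))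
  simp [← ofReal_norm, this, hp]

theorem IsTestFunction.lintegral_ne_zero (hu : IsTestFunction Ω u) {p : ℝ} (hp : 0 < p) :
    ∫⁻ x, ‖u x‖ₑ ^ p ≠ 0 := by
  have hc := hu.1.continuous
  intro h
  rw [lintegral_eq_zero_iff (hc.measurable.enorm.pow_const p)] at h
  refine hu.2.2.2 ((hc.ae_eq_iff_eq volume (g := fun _ => 0) continuous_const).1 ?_)
  filter_upwards [h] with x hx
  simpa [hp, hp.not_gt] using hx

theorem IsTestFunction.lintegral_ne_top (hu : IsTestFunction Ω u) {p : ℝ} (hp : 0 < p) :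
    ∫⁻ x, ‖u x‖ₑ ^ p ≠ ⊤ := by
  have h := lintegral_rpow_enorm_lt_top_of_eLpNorm_lt_top (by simpa using hp)
    ENNReal.ofReal_ne_top
    (hu.1.continuous.memLp_of_hasCompactSupport (p := ENNReal.ofReal p) (μ := volume)
      hu.2.1).eLpNorm_lt_top
  rw [ENNReal.toReal_ofReal hp.le] at h
  exact h.ne

end TestFunction

/-! ### The lower bound -/

section LowerBound

/-- Each line in the direction `n` meets `T` in an interval of length at most `R` issuing from the
hyperplane `⟨x, n⟩ + c = 0`, where `u` vanishes. The one-dimensional inequality applies on the line,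
and the derivative along the unit vector `n` is bounded by the full derivative. -/
theorem poincareConst_rpow_mul_setLIntegral_le {E : Type*} [NormedAddCommGroup E]
    [InnerProductSpace ℝ E] [FiniteDimensional ℝ E] [MeasurableSpace E] [BorelSpace E]
    {p : ℝ} (hp : 1 < p) {u : E → ℝ} (hu : ContDiff ℝ 1 u) {n : E} (hn : ‖n‖ = 1) (c R : ℝ)
    {T : Set E} (hT : MeasurableSet T) (hTR : ∀ x ∈ T, inner ℝ x n + c ∈ Set.Icc 0 R)
    (hT' : ∀ x ∈ T, ∀ s : ℝ, 0 ≤ s → s ≤ inner ℝ x n + c → x - s • n ∈ T)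
    (hu0 : ∀ x, inner ℝ x n + c = 0 → u x = 0) :
    (poincareConst p / ENNReal.ofReal (2 * R)) ^ p * ∫⁻ x in T, ‖u x‖ₑ ^ p ≤
      ∫⁻ x in T, ‖fderiv ℝ u x‖ₑ ^ p := by
  have hm1 : Measurable fun x => ‖u x‖ₑ ^ p := hu.continuous.measurable.enorm.pow_const p
  have hm2 : Measurable fun x => ‖fderiv ℝ u x‖ₑ ^ p :=
    (hu.continuous_fderiv one_ne_zero).measurable.enorm.pow_const p
  rw [← lintegral_indicator hT, ← lintegral_indicator hT]
  refine mul_lintegral_le_of_slices hn (hm1.indicator hT) (hm2.indicator hT) _ fun x => ?_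
  set l : ℝ := inner ℝ x n + c with hl
  -- The foot of the perpendicular from `x` to the hyperplane: with `y` as base point, the parameter
  -- on the line is the signed distance to the hyperplane.
  set y : E := x - l • n with hy
  have hyt : ∀ t : ℝ, inner ℝ (y + t • n) n + c = t := fun t => by
    rw [hy, sub_eq_add_neg, ← neg_smul, inner_add_smul_of_norm_eq_one hn,
      inner_add_smul_of_norm_eq_one hn, hl]
    ring
  have hshift : ∀ F : E → ℝ≥0∞, ∫⁻ t : ℝ, F (x + t • n) = ∫⁻ t : ℝ, F (y + t • n) := fun F => by
    rw [← lintegral_sub_right_eq_self (fun t : ℝ => F (x + t • n)) l]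
    refine lintegral_congr fun t => ?_
    congr 1
    rw [hy, sub_smul]; abel
  set f : ℝ → ℝ := fun t => u (y + t • n) with hf
  have hfC : ContDiff ℝ 1 f := by fun_prop
  have hfd : ∀ t, ‖deriv f t‖ₑ ≤ ‖fderiv ℝ u (y + t • n)‖ₑ := fun t => by
    have h1 : HasDerivAt (fun t : ℝ => y + t • n) n t := by
      simpa using ((hasDerivAt_id t).smul_const n).const_add y
    have h2 := ((hu.differentiable one_ne_zero (y + t • n)).hasFDerivAt).comp_hasDerivAt t h1
    rw [show deriv f t = _ from h2.deriv]
    refine (ContinuousLinearMap.le_opENorm _ _).trans ?_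
    rw [← ofReal_norm n, hn]; simp
  set S : Set ℝ := {t | y + t • n ∈ T} with hS
  have hSm : MeasurableSet S := hT.preimage (by fun_prop)
  have key := poincareConst_rpow_mul_le_of_isLowerSet hp hfC (S := S) (R := R)
    (hu0 _ (hyt 0)) (fun t ht => by simpa only [hyt] using hTR _ ht) (fun t ht s hs hst => by
      have := hT' _ ht (t - s) (by linarith) (by rw [hyt]; linarith)
      rwa [add_sub_assoc, ← sub_smul, sub_sub_cancel] at this)
  rw [hshift, hshift]
  calc _ = (poincareConst p / ENNReal.ofReal (2 * R)) ^ p * ∫⁻ t in S, ‖f t‖ₑ ^ p := by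
        rw [← lintegral_indicator hSm]; rfl
    _ ≤ ∫⁻ t in S, ‖deriv f t‖ₑ ^ p := key
    _ ≤ ∫⁻ t in S, ‖fderiv ℝ u (y + t • n)‖ₑ ^ p := by
        refine lintegral_mono fun t => ?_
        gcongr
        exact hfd t
    _ = _ := by rw [← lintegral_indicator hSm]; rfl

variable {N : ℕ} {Ω : Set (EuclideanSpace ℝ (Fin N))}

/-- Every point of an open convex set of inradius less than `R` is at distance less than `R` from
the boundary of some half-space containing the set. -/
theorem exists_halfSpace_of_inradius_lt (ho : IsOpen Ω) (hc : Convex ℝ Ω) {R : ℝ}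
    (hR : inradius Ω < ENNReal.ofReal R) {x : EuclideanSpace ℝ (Fin N)} (hx : x ∈ Ω) :
    ∃ (n : EuclideanSpace ℝ (Fin N)) (c : ℝ), ‖n‖ = 1 ∧ (∀ y ∈ Ω, 0 < inner ℝ y n + c) ∧
      inner ℝ x n + c < R := by
  have hb : ¬ Metric.ball x R ⊆ Ω := fun h =>
    hR.not_ge (le_iSup_of_le x (le_iSup₂_of_le R h le_rfl))
  obtain ⟨z, hz, hzΩ⟩ := Set.not_subset.1 hb
  obtain ⟨f, hf⟩ := geometric_hahn_banach_open_point hc ho hzΩ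
  set w := (InnerProductSpace.toDual ℝ (EuclideanSpace ℝ (Fin N))).symm f with hw
  have hfw : ∀ y, inner ℝ y w = f y := fun y => by
    rw [real_inner_comm, hw, InnerProductSpace.toDual_symm_apply]
  have hw0 : 0 < ‖w‖ := by
    rw [norm_pos_iff]
    intro h0
    have := hf x hx
    rw [← hfw, ← hfw, h0] at this
    simp at this
  have hn : ‖(-‖w‖⁻¹) • w‖ = 1 := by
    rw [norm_smul, norm_neg, norm_inv, norm_norm, inv_mul_cancel₀ hw0.ne']
  -- The inner unit normal of the separating hyperplane, which is made to pass through `z`; so the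
  -- distance from `x` to it is at most `dist x z < R`.
  refine ⟨(-‖w‖⁻¹) • w, -inner ℝ z ((-‖w‖⁻¹) • w), hn, fun y hy => ?_, ?_⟩
  · rw [real_inner_smul_right, real_inner_smul_right, hfw, hfw]
    have := mul_pos (inv_pos.2 hw0) (sub_pos.2 (hf y hy))
    linarith
  · rw [← sub_eq_add_neg, ← inner_sub_left]
    refine (real_inner_le_norm _ _).trans_lt ?_
    rw [hn, mul_one, ← dist_eq_norm, dist_comm]
    exact hz

/-- Being closer than `R` to a given hyperplane is an open condition, so compactness of `K` leaves
finitely many half-spaces. -/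
theorem exists_halfSpaces_of_inradius_lt (ho : IsOpen Ω) (hc : Convex ℝ Ω) {R : ℝ}
    (hR : inradius Ω < ENNReal.ofReal R) {K : Set (EuclideanSpace ℝ (Fin N))} (hK : IsCompact K)
    (hKΩ : K ⊆ Ω) :
    ∃ (m : ℕ) (n : Fin m → EuclideanSpace ℝ (Fin N)) (c : Fin m → ℝ), (∀ i, ‖n i‖ = 1) ∧
      (∀ i, ∀ y ∈ Ω, 0 < inner ℝ y (n i) + c i) ∧ ∀ x ∈ K, ∃ i, inner ℝ x (n i) + c i < R := by
  set ι := {a : EuclideanSpace ℝ (Fin N) × ℝ // ‖a.1‖ = 1 ∧ ∀ y ∈ Ω, 0 < inner ℝ y a.1 + a.2}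
  obtain ⟨t, ht⟩ := hK.elim_finite_subcover (fun i : ι => {x | inner ℝ x i.1.1 + i.1.2 < R})
    (fun i => isOpen_lt (by fun_prop) continuous_const) fun x hx => by
      obtain ⟨n, c, hn, h1, h2⟩ := exists_halfSpace_of_inradius_lt ho hc hR (hKΩ hx)
      exact Set.mem_iUnion.2 ⟨⟨(n, c), hn, h1⟩, h2⟩
  refine ⟨t.card, fun i => (t.equivFin.symm i).1.1.1, fun i => (t.equivFin.symm i).1.1.2,
    fun i => (t.equivFin.symm i).1.2.1, fun i => (t.equivFin.symm i).1.2.2, fun x hx => ?_⟩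
  obtain ⟨i, hi, hxi⟩ := Set.mem_iUnion₂.1 (ht hx)
  exact ⟨t.equivFin ⟨i, hi⟩, by simpa using hxi⟩

theorem poincareConst_rpow_mul_lintegral_le {p : ℝ} (hp : 1 < p) (ho : IsOpen Ω)
    (hc : Convex ℝ Ω) {R : ℝ} (hR : inradius Ω < ENNReal.ofReal R)
    {u : EuclideanSpace ℝ (Fin N) → ℝ} (hu : IsTestFunction Ω u) :
    (poincareConst p / ENNReal.ofReal (2 * R)) ^ p * ∫⁻ x, ‖u x‖ₑ ^ p ≤
      ∫⁻ x, ‖fderiv ℝ u x‖ₑ ^ p := by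
  have hp0 : 0 < p := by linarith
  obtain ⟨m, n, c, hn, hΩ, hK⟩ := exists_halfSpaces_of_inradius_lt ho hc hR hu.2.1 hu.2.2.1
  set l : Fin m → EuclideanSpace ℝ (Fin N) → ℝ := fun i x => inner ℝ x (n i) + c i with hl
  have hlm : ∀ i, Measurable (l i) := fun i => by fun_prop
  -- The cell of points whose nearest hyperplane is the `i`-th one, ties going to the smallest
  -- index, which makes the cells disjoint.
  set T : Fin m → Set (EuclideanSpace ℝ (Fin N)) := fun i =>
    {x | l i x ∈ Set.Icc 0 R ∧ ∀ j, l i x ≤ l j x ∧ (j < i → l i x < l j x)} with hT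
  have hTm : ∀ i, MeasurableSet (T i) := fun i => by
    have : T i = l i ⁻¹' Set.Icc 0 R ∩ ⋂ j, {x | l i x ≤ l j x} ∩ {x | j < i → l i x < l j x} := by
      ext x; simp [hT]
    rw [this]
    refine ((hlm i) measurableSet_Icc).inter
      (MeasurableSet.iInter fun j => (measurableSet_le (hlm i) (hlm j)).inter ?_)
    by_cases hji : j < i
    · simpa [hji] using measurableSet_lt (hlm i) (hlm j)
    · simp [hji]
  have hTd : Pairwise (Function.onFun Disjoint T) := by
    intro i j hij
    refine Set.disjoint_left.2 fun x hxi hxj => ?_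
    rcases hij.lt_or_gt with h | h
    · exact absurd ((hxj.2 i).2 h) (not_lt.2 (hxi.2 j).1)
    · exact absurd ((hxi.2 j).2 h) (not_lt.2 (hxj.2 i).1)
  have hcov : ∀ x, u x ≠ 0 → x ∈ ⋃ i, T i := by
    intro x hx
    have hxK : x ∈ tsupport u := subset_tsupport u hx
    obtain ⟨i₀, hi₀⟩ := hK x hxK
    have : Nonempty (Fin m) := ⟨i₀⟩
    -- The lexicographic minimum selects, among the nearest hyperplanes, the one of smallest index.
    obtain ⟨i, hi⟩ := Finite.exists_min fun i => toLex (l i x, i)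
    simp only [Prod.Lex.le_iff, ofLex_toLex] at hi
    have hle : ∀ j, l i x ≤ l j x := fun j => (hi j).elim le_of_lt fun h => h.1.le
    refine Set.mem_iUnion.2 ⟨i, ⟨(hΩ i x (hu.2.2.1 hxK)).le, (hle i₀).trans hi₀.le⟩, fun j =>
      ⟨hle j, fun hji => (hi j).elim id fun h => absurd h.2 (not_le.2 hji)⟩⟩
  have hpiece : ∀ i, (poincareConst p / ENNReal.ofReal (2 * R)) ^ p * ∫⁻ x in T i, ‖u x‖ₑ ^ p ≤
      ∫⁻ x in T i, ‖fderiv ℝ u x‖ₑ ^ p := by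
    intro i
    refine poincareConst_rpow_mul_setLIntegral_le hp (hu.1.of_le (by simp)) (hn i) (c i) R
      (hTm i) (fun x hx => hx.1) (fun x hx s hs hsl => ?_) fun x hx => ?_
    · have hli : l i (x - s • n i) = l i x - s := by
        simp only [hl]
        rw [sub_eq_add_neg, ← neg_smul, inner_add_smul_of_norm_eq_one (hn i)]; ring
      -- Moving by `s` along `-n i` lowers `l i` by exactly `s` and any `l j` by at most `s`, since
      -- `⟨n i, n j⟩ ≤ 1`. Hence the motion towards the face stays in the cell.
      have hlj : ∀ j, l j x - s ≤ l j (x - s • n i) := fun j => by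
        simp only [hl]
        rw [inner_sub_left, real_inner_smul_left]
        have h1 := real_inner_le_norm (n i) (n j)
        rw [hn, hn, mul_one] at h1
        nlinarith
      refine ⟨?_, fun j => ⟨?_, fun hji => ?_⟩⟩
      · rw [hli]
        exact ⟨sub_nonneg.2 hsl, by linarith [hx.1.2]⟩
      · rw [hli]; linarith [(hx.2 j).1, hlj j]
      · rw [hli]; linarith [(hx.2 j).2 hji, hlj j]
    · by_contra hne
      exact (hΩ i x (hu.2.2.1 (subset_tsupport u hne))).ne' hx
  calc _ = (poincareConst p / ENNReal.ofReal (2 * R)) ^ p * ∫⁻ x in ⋃ i, T i, ‖u x‖ₑ ^ p := by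
        congr 1
        refine (setLIntegral_eq_of_support_subset fun x hx => hcov x fun h => hx ?_).symm
        simp [h, hp0]
    _ = ∑' i, (poincareConst p / ENNReal.ofReal (2 * R)) ^ p * ∫⁻ x in T i, ‖u x‖ₑ ^ p := by
        rw [lintegral_iUnion hTm hTd, ENNReal.tsum_mul_left]
    _ ≤ ∑' i, ∫⁻ x in T i, ‖fderiv ℝ u x‖ₑ ^ p := ENNReal.tsum_le_tsum hpiece
    _ = ∫⁻ x in ⋃ i, T i, ‖fderiv ℝ u x‖ₑ ^ p := (lintegral_iUnion hTm hTd _).symm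
    _ ≤ _ := setLIntegral_le_lintegral _ _

theorem inradius_ne_zero (ho : IsOpen Ω) (hne : Ω.Nonempty) : inradius Ω ≠ 0 := by
  obtain ⟨x, hx⟩ := hne
  obtain ⟨r, hr, hb⟩ := Metric.isOpen_iff.1 ho x hx
  have : ENNReal.ofReal r ≤ inradius Ω := le_iSup_of_le x (le_iSup₂_of_le r hb le_rfl)
  exact ((ENNReal.ofReal_pos.2 hr).trans_le this).ne'

theorem div_two_rpow_mul_one_div_rpow {p : ℝ} (hp : 0 ≤ p) (x R : ℝ≥0∞) :
    (x / 2) ^ p * (1 / R ^ p) = (x / (2 * R)) ^ p := by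
  rw [one_div, ← ENNReal.inv_rpow, ← ENNReal.mul_rpow_of_nonneg _ _ hp, div_eq_mul_inv,
    div_eq_mul_inv, ENNReal.mul_inv (by simp) (by simp), mul_assoc]

/-- The Hersch–Protter inequality for the `p`-Laplacian. -/
theorem poincareConst_div_inradius_le_firstEigenvalue {p : ℝ} (hp : 1 < p) (ho : IsOpen Ω)
    (hc : Convex ℝ Ω) :
    (poincareConst p / 2) ^ p * (1 / inradius Ω ^ p) ≤ firstEigenvalue p Ω := by
  have hp0 : 0 < p := by linarith
  refine le_iInf₂ fun u hu => ?_
  rw [hu.setLIntegral_eq hp0, hu.setLIntegral_gradient_eq hp0]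
  have hY0 := hu.lintegral_ne_zero hp0
  have hYt := hu.lintegral_ne_top hp0
  rw [ENNReal.le_div_iff_mul_le (Or.inl hY0) (Or.inl hYt)]
  have hne : Ω.Nonempty := by
    by_contra h
    rw [Set.not_nonempty_iff_eq_empty] at h
    exact hu.2.2.2 (funext fun x => hu.eq_zero (by simp [h]))
  rcases eq_or_ne (inradius Ω) ⊤ with htop | htop
  · simp [htop, hp0]
  have hr0 : 0 < (inradius Ω).toReal := ENNReal.toReal_pos (inradius_ne_zero ho hne) htop
  -- The bound holds for every `R` above the inradius; it passes to the limit because `∫ |u|^p` is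
  -- finite.
  have hlim : Tendsto (fun R : ℝ => (poincareConst p / ENNReal.ofReal (2 * R)) ^ p *
      ∫⁻ x, ‖u x‖ₑ ^ p) (𝓝[>] (inradius Ω).toReal)
      (𝓝 ((poincareConst p / ENNReal.ofReal (2 * (inradius Ω).toReal)) ^ p *
        ∫⁻ x, ‖u x‖ₑ ^ p)) := by
    refine ENNReal.Tendsto.mul_const (Tendsto.ennrpow_const p
      (ENNReal.Tendsto.const_div ?_ (Or.inl ENNReal.ofReal_ne_top))) (Or.inr hYt)
    exact ENNReal.tendsto_ofReal ((tendsto_id.mono_left nhdsWithin_le_nhds).const_mul 2)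
  have heq : (poincareConst p / ENNReal.ofReal (2 * (inradius Ω).toReal)) ^ p =
      (poincareConst p / 2) ^ p * (1 / inradius Ω ^ p) := by
    rw [ENNReal.ofReal_mul zero_le_two, ENNReal.ofReal_toReal htop,
      div_two_rpow_mul_one_div_rpow hp0.le, ENNReal.ofReal_ofNat]
  rw [← heq]
  refine le_of_tendsto hlim ?_
  filter_upwards [self_mem_nhdsWithin] with R hR
  exact poincareConst_rpow_mul_lintegral_le hp ho hc
    ((ENNReal.lt_ofReal_iff_toReal_lt htop).2 hR) hu

end LowerBound

/-! ### Upper bounds through product test functions -/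

section UpperBound

variable {N : ℕ} {Ω : Set (EuclideanSpace ℝ (Fin N))}

/-- A bump function evaluated at the component of `x` orthogonal to `v`. -/
theorem exists_transverse_cutoff {v : EuclideanSpace ℝ (Fin N)} (hv : ‖v‖ = 1) {r : ℝ}
    (hr : 0 < r) :
    ∃ Ψ : EuclideanSpace ℝ (Fin N) → ℝ, ContDiff ℝ ∞ Ψ ∧ (∀ x (t : ℝ), Ψ (x + t • v) = Ψ x) ∧
      (∀ x, Ψ x ≠ 0 → ‖x - inner ℝ x v • v‖ ≤ r) ∧ Ψ 0 = 1 := by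
  set ψ : ContDiffBump (0 : EuclideanSpace ℝ (Fin N)) := ⟨r / 2, r, by linarith, by linarith⟩
  refine ⟨fun x => ψ (x - inner ℝ x v • v), ψ.contDiff.comp (contDiff_id.sub
    ((contDiff_id.inner ℝ contDiff_const).smul contDiff_const)), fun x t => ?_,
    fun x hx => ?_, ?_⟩
  · beta_reduce
    rw [inner_add_smul_of_norm_eq_one hv, add_smul]
    congr 1
    abel
  · have : x - inner ℝ x v • v ∈ Function.support ψ := hx
    rw [ψ.support_eq, mem_ball_zero_iff] at this
    exact this.le
  · simp only [inner_zero_left, zero_smul, sub_zero]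
    exact ψ.one_of_mem_closedBall (Metric.mem_closedBall_self ψ.rIn_pos.le)

theorem norm_le_of_transverse {v : EuclideanSpace ℝ (Fin N)} (hv : ‖v‖ = 1) {r s : ℝ}
    {x : EuclideanSpace ℝ (Fin N)} (h1 : ‖x - inner ℝ x v • v‖ ≤ r) (h2 : |inner ℝ x v| ≤ s) :
    ‖x‖ ≤ s + r := by
  calc ‖x‖ = ‖inner ℝ x v • v + (x - inner ℝ x v • v)‖ := by congr 1; abel
    _ ≤ ‖inner ℝ x v • v‖ + ‖x - inner ℝ x v • v‖ := norm_add_le _ _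
    _ ≤ s + r := by
        rw [norm_smul, hv, mul_one, Real.norm_eq_abs]
        exact add_le_add h2 h1

theorem isTestFunction_product {v : EuclideanSpace ℝ (Fin N)} (hv : ‖v‖ = 1) {r a d : ℝ}
    (hd : 0 < d) {φ : ℝ → ℝ} (hφ : ContDiff ℝ ∞ φ) {δ : ℝ} (hδ : 0 < δ)
    (hφs : ∀ t, φ t ≠ 0 → t ∈ Set.Icc δ (1 - δ)) {t₀ : ℝ} (ht₀ : φ t₀ ≠ 0)
    {Ψ : EuclideanSpace ℝ (Fin N) → ℝ} (hΨ : ContDiff ℝ ∞ Ψ)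
    (hΨv : ∀ x (t : ℝ), Ψ (x + t • v) = Ψ x)
    (hΨs : ∀ x, Ψ x ≠ 0 → ‖x - inner ℝ x v • v‖ ≤ r) (hΨ0 : Ψ 0 = 1)
    (hΩ : ∀ x, inner ℝ x v ∈ Set.Ioo a (a + d) → ‖x - inner ℝ x v • v‖ ≤ r → x ∈ Ω) :
    IsTestFunction Ω fun x => φ (d⁻¹ * (inner ℝ x v - a)) * Ψ x := by
  set K : Set (EuclideanSpace ℝ (Fin N)) :=
    {x | d⁻¹ * (inner ℝ x v - a) ∈ Set.Icc δ (1 - δ) ∧ ‖x - inner ℝ x v • v‖ ≤ r} with hK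
  have hKc : IsClosed K := (isClosed_Icc.preimage
    (by fun_prop : Continuous fun x : EuclideanSpace ℝ (Fin N) => d⁻¹ * (inner ℝ x v - a))).inter
    (isClosed_le (f := fun x : EuclideanSpace ℝ (Fin N) => ‖x - inner ℝ x v • v‖) (by fun_prop)
      continuous_const)
  have hKI : ∀ x ∈ K, inner ℝ x v ∈ Set.Ioo a (a + d) := fun x hx => by
    obtain ⟨⟨h1, h2⟩, -⟩ := hx
    rw [le_inv_mul_iff₀ hd] at h1
    rw [inv_mul_le_iff₀ hd] at h2
    constructor <;> nlinarith
  have hKcomp : IsCompact K := by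
    refine (isCompact_closedBall (0 : EuclideanSpace ℝ (Fin N))
      (max |a| |a + d| + r)).of_isClosed_subset hKc fun x hx => ?_
    rw [mem_closedBall_zero_iff]
    exact norm_le_of_transverse hv hx.2 (abs_le_max_abs_abs (hKI x hx).1.le (hKI x hx).2.le)
  have hsup : tsupport (fun x => φ (d⁻¹ * (inner ℝ x v - a)) * Ψ x) ⊆ K :=
    closure_minimal (fun x hx => ⟨hφs _ (left_ne_zero_of_mul hx), hΨs _ (right_ne_zero_of_mul hx)⟩)
      hKc
  refine ⟨(hφ.comp (contDiff_const.mul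
    ((contDiff_id.inner ℝ contDiff_const).sub contDiff_const))).mul hΨ,
    hKcomp.of_isClosed_subset (isClosed_tsupport _) hsup,
    fun x hx => hΩ x (hKI x (hsup hx)) (hsup hx).2, fun h => ?_⟩
  have h1 := congrFun h (0 + (a + d * t₀) • v)
  beta_reduce at h1
  rw [hΨv, inner_add_smul_of_norm_eq_one hv, inner_zero_left, hΨ0, zero_add, add_sub_cancel_left,
    mul_one, inv_mul_cancel_left₀ hd.ne'] at h1
  exact ht₀ h1

theorem lintegral_comp_affine {d : ℝ} (hd : 0 < d) (a : ℝ) (F : ℝ → ℝ≥0∞) :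
    ∫⁻ t, F (d⁻¹ * (t - a)) = ENNReal.ofReal d * ∫⁻ t, F t := by
  rw [lintegral_sub_right_eq_self (fun t => F (d⁻¹ * t)) a]
  have := lintegral_comp_smul_addHaar volume F (inv_ne_zero hd.ne')
  simpa [abs_of_pos hd] using this

/-- If `Ω` contains a box of width `d` in the direction `v` and of a fixed size in the transverse
directions, then `λ_p(Ω)` is at most about `(π_p / d)^p` for small `d`. -/
theorem exists_firstEigenvalue_rpow_le {p : ℝ} (hp : 1 < p) {q : ℝ≥0∞} (hq : poincareConst p < q)
    {v : EuclideanSpace ℝ (Fin N)} (hv : ‖v‖ = 1) {r : ℝ} (hr : 0 < r) :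
    ∃ B : ℝ≥0∞, B ≠ ⊤ ∧ ∀ (Ω : Set (EuclideanSpace ℝ (Fin N))) (a d : ℝ), 0 < d →
      (∀ x, inner ℝ x v ∈ Set.Ioo a (a + d) → ‖x - inner ℝ x v • v‖ ≤ r → x ∈ Ω) →
      firstEigenvalue p Ω ≤ (q / ENNReal.ofReal d + B) ^ p := by
  have hp0 : 0 < p := by linarith
  obtain ⟨φ, hφC, ⟨δ, hδ, hφs⟩, hA0, hA1⟩ := exists_contDiff_rayleigh_le hp hq
  obtain ⟨Ψ, hΨC, hΨv, hΨs, hΨ0⟩ := exists_transverse_cutoff hv hr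
  obtain ⟨t₀, ht₀⟩ : ∃ t, φ t ≠ 0 := by
    by_contra! h
    exact hA0 (by simp [h, hp0])
  have hΨd : ∀ x (t : ℝ), fderiv ℝ Ψ (x + t • v) = fderiv ℝ Ψ x := fun x t => by
    rw [← fderiv_comp_add_right]
    simp only [hΨv]
  have hmφ : Measurable fun t => ‖φ t‖ₑ ^ p := hφC.continuous.measurable.enorm.pow_const p
  have hmφ' : Measurable fun t => ‖deriv φ t‖ₑ ^ p :=
    (hφC.continuous_deriv (by simp)).measurable.enorm.pow_const p
  have hmΨ : Measurable fun x => ‖Ψ x‖ₑ ^ p := hΨC.continuous.measurable.enorm.pow_const p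
  have hΨc' : Continuous (fderiv ℝ Ψ) := hΨC.continuous_fderiv (by simp)
  have hmΨ' : Measurable fun x => ‖fderiv ℝ Ψ x‖ₑ ^ p := hΨc'.measurable.enorm.pow_const p
  set A : Set (EuclideanSpace ℝ (Fin N)) := {x | inner ℝ x v ∈ Set.Ico (0 : ℝ) 1} with hA
  -- The transverse integrals of the cutoff and of its derivative. They do not involve `Ω`, `a` or
  -- `d`, so `B = (c₂ / c₁) ^ (1 / p)` is uniform.
  set c₁ := ∫⁻ x in A, ‖Ψ x‖ₑ ^ p with hc₁
  set c₂ := ∫⁻ x in A, ‖fderiv ℝ Ψ x‖ₑ ^ p with hc₂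
  set A₀ := ∫⁻ t, ‖φ t‖ₑ ^ p with hA₀
  have hden : ∀ a d : ℝ, 0 < d → ∫⁻ x, ‖φ (d⁻¹ * (inner ℝ x v - a)) * Ψ x‖ₑ ^ p =
      ENNReal.ofReal d * A₀ * c₁ := fun a d hd => by
    simp only [enorm_mul, ENNReal.mul_rpow_of_nonneg _ _ hp0.le]
    rw [lintegral_comp_inner_mul hv (f := fun t => ‖φ (d⁻¹ * (t - a))‖ₑ ^ p)
      (hmφ.comp (by fun_prop : Measurable fun t => d⁻¹ * (t - a))) hmΨ fun x t => by rw [hΨv],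
      lintegral_comp_affine hd a fun t => ‖φ t‖ₑ ^ p]
  have hc₁0 : c₁ ≠ 0 := by
    have h := (isTestFunction_product hv (a := 0) zero_lt_one hφC hδ hφs ht₀ hΨC hΨv hΨs hΨ0
      (Ω := Set.univ) fun _ _ _ => trivial).lintegral_ne_zero hp0
    rw [hden 0 1 zero_lt_one] at h
    exact right_ne_zero_of_mul h
  have hc₂t : c₂ ≠ ⊤ := by
    obtain ⟨M, hM⟩ := (isCompact_closedBall (0 : EuclideanSpace ℝ (Fin N))
      (1 + r)).exists_bound_of_continuousOn hΨc'.continuousOn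
    have hAm : MeasurableSet A :=
      measurableSet_Ico.preimage (by fun_prop :
        Measurable fun x : EuclideanSpace ℝ (Fin N) => inner ℝ x v)
    have hle : c₂ ≤ ∫⁻ x in Metric.closedBall (0 : EuclideanSpace ℝ (Fin N)) (1 + r),
        ENNReal.ofReal M ^ p := by
      rw [hc₂, ← lintegral_indicator hAm,
        ← lintegral_indicator Metric.isClosed_closedBall.measurableSet]
      refine lintegral_mono fun x => ?_
      by_cases hx : x ∈ A
      · rw [Set.indicator_of_mem hx]
        by_cases hz : fderiv ℝ Ψ x = 0
        · simp [← ofReal_norm, hz, hp0]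
        · have hts : tsupport Ψ ⊆ {x | ‖x - inner ℝ x v • v‖ ≤ r} :=
            closure_minimal hΨs (isClosed_le (by fun_prop) continuous_const)
          have hxr := hts (tsupport_fderiv_subset ℝ (subset_tsupport _ hz))
          have hxb : x ∈ Metric.closedBall (0 : EuclideanSpace ℝ (Fin N)) (1 + r) := by
            rw [mem_closedBall_zero_iff]
            refine norm_le_of_transverse hv hxr ?_
            rw [abs_of_nonneg hx.1]
            exact hx.2.le
          rw [Set.indicator_of_mem hxb]
          gcongr
          rw [← ofReal_norm]
          exact ENNReal.ofReal_le_ofReal (hM x hxb)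
      · rw [Set.indicator_of_notMem hx]
        exact zero_le
    refine (hle.trans_lt ?_).ne
    rw [setLIntegral_const]
    exact ENNReal.mul_lt_top (ENNReal.rpow_lt_top_of_nonneg hp0.le ENNReal.ofReal_ne_top)
      measure_closedBall_lt_top
  refine ⟨(c₂ / c₁) ^ (1 / p), ENNReal.rpow_ne_top_of_nonneg (by positivity)
    (ENNReal.div_ne_top hc₂t hc₁0), fun Ω a d hd hΩ => ?_⟩
  have hu := isTestFunction_product hv hd hφC hδ hφs ht₀ hΨC hΨv hΨs hΨ0 hΩ
  have hDn0 := hu.lintegral_ne_zero hp0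
  have hDnt := hu.lintegral_ne_top hp0
  refine (iInf₂_le _ hu).trans ?_
  rw [hu.setLIntegral_eq hp0, hu.setLIntegral_gradient_eq hp0]
  refine ENNReal.div_le_of_le_mul ?_
  rw [hden a d hd] at hDn0 hDnt ⊢
  have hc₁t : c₁ ≠ ⊤ := by
    intro h
    rw [h, ENNReal.mul_top (left_ne_zero_of_mul hDn0)] at hDnt
    exact hDnt rfl
  set D := ENNReal.ofReal d with hD
  have hD0 : D ≠ 0 := by simpa [hD] using hd
  set F₁ : EuclideanSpace ℝ (Fin N) → ℝ≥0∞ :=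
    fun x => D⁻¹ * (‖deriv φ (d⁻¹ * (inner ℝ x v - a))‖ₑ * ‖Ψ x‖ₑ) with hF₁
  set F₂ : EuclideanSpace ℝ (Fin N) → ℝ≥0∞ :=
    fun x => ‖φ (d⁻¹ * (inner ℝ x v - a))‖ₑ * ‖fderiv ℝ Ψ x‖ₑ with hF₂
  have hF₁m : Measurable F₁ := by
    have := (hφC.continuous_deriv (by simp)).measurable
    have := hΨC.continuous.measurable
    fun_prop
  have hF₂m : Measurable F₂ := by
    have := hφC.continuous.measurable
    have := hΨc'.measurable
    fun_prop
  -- The product rule separates the derivative along `v`, of order `1 / d`, from the transverse one;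
  -- Minkowski's inequality then adds their `L^p` norms.
  have hpt : ∀ x, ‖fderiv ℝ (fun x => φ (d⁻¹ * (inner ℝ x v - a)) * Ψ x) x‖ₑ ≤ (F₁ + F₂) x := by
    intro x
    set L : EuclideanSpace ℝ (Fin N) →L[ℝ] ℝ := innerSL ℝ v with hL
    have h1 : HasFDerivAt (fun x => d⁻¹ * (inner ℝ x v - a)) (d⁻¹ • L) x := by
      have : HasFDerivAt (fun x => inner ℝ x v) L x := by
        rw [show (fun x => inner ℝ x v) = L from funext fun x => real_inner_comm _ _]
        exact L.hasFDerivAt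
      exact (this.sub_const a).const_mul d⁻¹
    have h2 := ((hφC.differentiable (by simp) _).hasDerivAt.comp_hasFDerivAt x h1).mul
      (hΨC.differentiable (by simp) x).hasFDerivAt
    rw [show fderiv ℝ (fun x => φ (d⁻¹ * (inner ℝ x v - a)) * Ψ x) x = _ from h2.fderiv, add_comm]
    have hadd : ∀ f g : EuclideanSpace ℝ (Fin N) →L[ℝ] ℝ, ‖f + g‖ₑ ≤ ‖f‖ₑ + ‖g‖ₑ := fun f g => by
      simp only [← ofReal_norm]
      rw [← ENNReal.ofReal_add (norm_nonneg _) (norm_nonneg _)]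
      exact ENNReal.ofReal_le_ofReal (norm_add_le f g)
    refine (hadd _ _).trans (add_le_add ?_ ?_)
    · have hLn : ‖L‖ₑ = 1 := by rw [← ofReal_norm, hL, innerSL_apply_norm, hv]; simp
      rw [enorm_smul, enorm_smul, enorm_smul, hLn, mul_one, hF₁,
        Real.enorm_of_nonneg (inv_pos.2 hd).le, ENNReal.ofReal_inv_of_pos hd, ← hD]
      refine le_of_eq ?_
      ring
    · rw [enorm_smul]; rfl
  have hI₁ : ∫⁻ x, F₁ x ^ p ≤ (q / D) ^ p * (D * A₀ * c₁) := by
    simp only [hF₁, ENNReal.mul_rpow_of_nonneg _ _ hp0.le]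
    rw [lintegral_const_mul' _ _ (ENNReal.rpow_ne_top_of_nonneg hp0.le (ENNReal.inv_ne_top.2 hD0)),
      lintegral_comp_inner_mul hv (f := fun t => ‖deriv φ (d⁻¹ * (t - a))‖ₑ ^ p)
      (hmφ'.comp (by fun_prop : Measurable fun t => d⁻¹ * (t - a))) hmΨ fun x t => by rw [hΨv],
      lintegral_comp_affine hd a fun t => ‖deriv φ t‖ₑ ^ p, div_eq_mul_inv,
      ENNReal.mul_rpow_of_nonneg _ _ hp0.le]
    calc _ ≤ D⁻¹ ^ p * (D * (q ^ p * A₀) * c₁) := by gcongr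
      _ = _ := by ring
  have hI₂ : ∫⁻ x, F₂ x ^ p = ((c₂ / c₁) ^ (1 / p)) ^ p * (D * A₀ * c₁) := by
    simp only [hF₂, ENNReal.mul_rpow_of_nonneg _ _ hp0.le]
    rw [lintegral_comp_inner_mul hv (f := fun t => ‖φ (d⁻¹ * (t - a))‖ₑ ^ p)
      (hmφ.comp (by fun_prop : Measurable fun t => d⁻¹ * (t - a))) hmΨ' fun x t => by rw [hΨd],
      lintegral_comp_affine hd a fun t => ‖φ t‖ₑ ^ p, ← ENNReal.rpow_mul,
      one_div_mul_cancel hp0.ne', ENNReal.rpow_one, mul_left_comm,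
      ENNReal.div_mul_cancel hc₁0 hc₁t]
  have hroot : ∀ s : ℝ≥0∞, (s ^ p * (D * A₀ * c₁)) ^ (1 / p) = s * (D * A₀ * c₁) ^ (1 / p) :=
    fun s => by
      rw [ENNReal.mul_rpow_of_nonneg _ _ (by positivity), ← ENNReal.rpow_mul,
        mul_one_div_cancel hp0.ne', ENNReal.rpow_one]
  have hmink : (∫⁻ x, ‖fderiv ℝ (fun x => φ (d⁻¹ * (inner ℝ x v - a)) * Ψ x) x‖ₑ ^ p) ^ (1 / p) ≤
      (q / D + (c₂ / c₁) ^ (1 / p)) * (D * A₀ * c₁) ^ (1 / p) := by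
    calc _ ≤ (∫⁻ x, (F₁ + F₂) x ^ p) ^ (1 / p) := by
          gcongr with x
          exact hpt x
      _ ≤ (∫⁻ x, F₁ x ^ p) ^ (1 / p) + (∫⁻ x, F₂ x ^ p) ^ (1 / p) :=
          ENNReal.lintegral_Lp_add_le hF₁m.aemeasurable hF₂m.aemeasurable hp.le
      _ ≤ ((q / D) ^ p * (D * A₀ * c₁)) ^ (1 / p) + _ := by
          gcongr
      _ = _ := by rw [hI₂, hroot, hroot, add_mul]
  have := ENNReal.rpow_le_rpow hmink hp0.le
  rwa [ENNReal.mul_rpow_of_nonneg _ _ hp0.le, ← ENNReal.rpow_mul, ← ENNReal.rpow_mul,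
    one_div_mul_cancel hp0.ne', ENNReal.rpow_one, ENNReal.rpow_one] at this

/-- Transplant `u` to `x ↦ u (s⁻¹ • x)`: the derivative gains a factor `s⁻¹`, and the Jacobians
cancel in the quotient. -/
theorem firstEigenvalue_le_div_of_smul_mem {p : ℝ} (hp : 1 < p)
    {Ω' : Set (EuclideanSpace ℝ (Fin N))} {s : ℝ} (hs : 0 < s) (h : ∀ x ∈ Ω', s • x ∈ Ω) :
    firstEigenvalue p Ω ≤ firstEigenvalue p Ω' / ENNReal.ofReal s ^ p := by
  have hp0 : 0 < p := by linarith
  have hs0 : ENNReal.ofReal s ≠ 0 := by simpa using hs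
  have hsp0 : ENNReal.ofReal s ^ p ≠ 0 := by simp [hp0, hp0.not_gt, hs]
  have hspt : ENNReal.ofReal s ^ p ≠ ⊤ :=
    ENNReal.rpow_ne_top_of_nonneg hp0.le ENNReal.ofReal_ne_top
  rw [ENNReal.le_div_iff_mul_le (Or.inl hsp0) (Or.inl hspt)]
  refine le_iInf₂ fun u hu => ?_
  rw [hu.setLIntegral_eq hp0, hu.setLIntegral_gradient_eq hp0]
  have hw : IsTestFunction Ω fun x => u (s⁻¹ • x) := by
    have hcs : HasCompactSupport fun x => u (s⁻¹ • x) :=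
      hu.2.1.comp_homeomorph (Homeomorph.smulOfNeZero s⁻¹ (inv_ne_zero hs.ne'))
    refine ⟨hu.1.comp (by fun_prop), hcs, fun x hx => ?_, fun hz => hu.2.2.2 (funext fun x => ?_)⟩
    · have h1 : s⁻¹ • x ∈ tsupport u :=
        tsupport_comp_subset_preimage u (f := fun x => s⁻¹ • x) (by fun_prop) hx
      simpa [smul_smul, hs.ne'] using h _ (hu.2.2.1 h1)
    · simpa [smul_smul, hs.ne'] using congrFun hz (s • x)
  have hd : ∀ x, ‖fderiv ℝ (fun x => u (s⁻¹ • x)) x‖ₑ =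
      (ENNReal.ofReal s)⁻¹ * ‖fderiv ℝ u (s⁻¹ • x)‖ₑ := fun x => by
    rw [fderiv_comp_smul, enorm_smul, Real.enorm_of_nonneg (inv_pos.2 hs).le,
      ENNReal.ofReal_inv_of_pos hs]
  have hle : firstEigenvalue p Ω ≤ _ := iInf₂_le _ hw
  rw [hw.setLIntegral_eq hp0, hw.setLIntegral_gradient_eq hp0] at hle
  simp only [hd, ENNReal.mul_rpow_of_nonneg _ _ hp0.le] at hle
  rw [lintegral_const_mul' _ _ (ENNReal.rpow_ne_top_of_nonneg hp0.le (ENNReal.inv_ne_top.2 hs0)),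
    lintegral_comp_smul_addHaar volume (fun x => ‖u x‖ₑ ^ p) (inv_ne_zero hs.ne'),
    lintegral_comp_smul_addHaar volume (fun x => ‖fderiv ℝ u x‖ₑ ^ p) (inv_ne_zero hs.ne'),
    mul_left_comm, ENNReal.mul_div_mul_left _ _ (by simp [hs.ne']) ENNReal.ofReal_ne_top,
    ENNReal.inv_rpow, mul_div_assoc] at hle
  calc _ ≤ _ := mul_le_mul_left hle _
    _ = _ := by rw [mul_right_comm, ENNReal.inv_mul_cancel hsp0 hspt, one_mul]

end UpperBound

/-! ### Sharpness: slabs and families of flat convex sets. -/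

section Sharpness

variable {N : ℕ} {Ω : Set (EuclideanSpace ℝ (Fin N))}

theorem inradius_le_of_subset_slab {v : EuclideanSpace ℝ (Fin N)} (hv : ‖v‖ = 1) {a b : ℝ}
    (h : ∀ x ∈ Ω, a ≤ inner ℝ x v ∧ inner ℝ x v ≤ b) :
    inradius Ω ≤ ENNReal.ofReal ((b - a) / 2) := by
  refine iSup_le fun x => iSup₂_le fun r hr => ?_
  rcases le_or_gt r 0 with hr0 | hr0
  · simp [ENNReal.ofReal_of_nonpos hr0]
  refine ENNReal.ofReal_le_ofReal (le_of_forall_lt fun s hs => ?_)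
  -- The ball is open, so its diameter along `v` is tested at radii `s'` slightly below `r`.
  obtain ⟨s', hs', hs'r⟩ := exists_between (max_lt hs hr0)
  have hs0 : 0 < s' := (le_max_right _ _).trans_lt hs'
  have hmem : ∀ t : ℝ, |t| = s' → x + t • v ∈ Ω := fun t ht => hr (by
    rw [Metric.mem_ball, dist_eq_norm, add_sub_cancel_left, norm_smul, hv, mul_one,
      Real.norm_eq_abs, ht]
    exact hs'r)
  have h1 := h _ (hmem s' (abs_of_pos hs0))
  have h2 := h _ (hmem (-s') (by rw [abs_neg, abs_of_pos hs0]))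
  rw [inner_add_smul_of_norm_eq_one hv] at h1 h2
  have h3 := (le_max_left _ _).trans_lt hs'
  linarith [h1.2, h2.1]

/-- Shrink the slab by a factor `s` and scale back: the transverse cost `B` becomes `B / s` and
vanishes as `s → ∞`. Then `q` decreases to `π_p`. -/
theorem firstEigenvalue_slab_le {p : ℝ} (hp : 1 < p) {v : EuclideanSpace ℝ (Fin N)} (hv : ‖v‖ = 1)
    {a b : ℝ} (hab : a < b) :
    firstEigenvalue p (slab v a b) ≤ (poincareConst p / ENNReal.ofReal (b - a)) ^ p := by
  have hp0 : 0 < p := by linarith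
  have hd : 0 < b - a := sub_pos.2 hab
  have hd0 : ENNReal.ofReal (b - a) ≠ 0 := by simpa using hab
  have hq : ∀ q, poincareConst p < q →
      firstEigenvalue p (slab v a b) ≤ (q / ENNReal.ofReal (b - a)) ^ p := by
    intro q hq
    obtain ⟨B, hB, hle⟩ := exists_firstEigenvalue_rpow_le hp hq hv zero_lt_one
    have hlim : Tendsto (fun s : ℝ => (q / ENNReal.ofReal (b - a) + B / ENNReal.ofReal s) ^ p) atTop
        (𝓝 ((q / ENNReal.ofReal (b - a) + B / ⊤) ^ p)) :=
      Tendsto.ennrpow_const p (tendsto_const_nhds.add (ENNReal.Tendsto.const_div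
        ENNReal.tendsto_ofReal_atTop (Or.inr hB)))
    rw [ENNReal.div_top, add_zero] at hlim
    refine ge_of_tendsto hlim ?_
    filter_upwards [eventually_gt_atTop 0] with s hs
    have hs0 : ENNReal.ofReal s ≠ 0 := by simpa using hs
    have h1 := firstEigenvalue_le_div_of_smul_mem (Ω := slab v a b)
      (Ω' := slab v (s⁻¹ * a) (s⁻¹ * b)) hp hs fun x hx => by
        obtain ⟨h1, h2⟩ := hx
        rw [inv_mul_lt_iff₀ hs] at h1
        rw [lt_inv_mul_iff₀ hs] at h2
        rw [slab, Set.mem_ofPred_eq, real_inner_smul_left]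
        exact ⟨h1, h2⟩
    have h2 := hle (slab v (s⁻¹ * a) (s⁻¹ * b)) (s⁻¹ * a) (s⁻¹ * (b - a)) (by positivity)
      fun x hx _ => ⟨hx.1, by rw [← mul_add, add_sub_cancel] at hx; exact hx.2⟩
    refine h1.trans ((ENNReal.div_le_div_right h2 _).trans_eq ?_)
    rw [← ENNReal.div_rpow_of_nonneg _ _ hp0.le, ENNReal.ofReal_mul (by positivity),
      ENNReal.ofReal_inv_of_pos hs, ENNReal.add_div]
    congr 2
    rw [div_eq_mul_inv, div_eq_mul_inv, div_eq_mul_inv, ENNReal.mul_inv (by simp) (by simp [hs0]),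
      inv_inv, mul_assoc, mul_right_comm (ENNReal.ofReal s),
      ENNReal.mul_inv_cancel hs0 ENNReal.ofReal_ne_top, one_mul]
  rcases eq_or_ne (poincareConst p) ⊤ with htop | htop
  · rw [htop, ENNReal.top_div_of_ne_top ENNReal.ofReal_ne_top, ENNReal.top_rpow_of_pos hp0]
    exact le_top
  have hne : (𝓝[>] poincareConst p).NeBot := nhdsGT_neBot_of_exists_gt ⟨⊤, htop.lt_top⟩
  have hlim : Tendsto (fun q => (q / ENNReal.ofReal (b - a)) ^ p) (𝓝[>] poincareConst p)
      (𝓝 ((poincareConst p / ENNReal.ofReal (b - a)) ^ p)) :=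
    Tendsto.ennrpow_const p
      (ENNReal.Tendsto.div_const (tendsto_id.mono_left nhdsWithin_le_nhds) (Or.inr hd0))
  refine ge_of_tendsto hlim ?_
  filter_upwards [self_mem_nhdsWithin] with q hq'
  exact hq q hq'

theorem isOpen_slab (v : EuclideanSpace ℝ (Fin N)) (a b : ℝ) : IsOpen (slab v a b) :=
  isOpen_Ioo.preimage (by fun_prop : Continuous fun x : EuclideanSpace ℝ (Fin N) => inner ℝ x v)

theorem convex_slab (v : EuclideanSpace ℝ (Fin N)) (a b : ℝ) : Convex ℝ (slab v a b) := by
  have : slab v a b = (fun x => inner ℝ x v) ⁻¹' Set.Ioo a b := rfl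
  rw [this]
  exact (convex_Ioo a b).is_linear_preimage
    ⟨fun x y => inner_add_left x y v, fun c x => real_inner_smul_left x v c⟩

theorem firstEigenvalue_slab {p : ℝ} (hp : 1 < p) {v : EuclideanSpace ℝ (Fin N)} (hv : ‖v‖ = 1)
    {a b : ℝ} (hab : a < b) :
    firstEigenvalue p (slab v a b) =
      (poincareConst p / 2) ^ p * (1 / inradius (slab v a b) ^ p) := by
  refine le_antisymm ((firstEigenvalue_slab_le hp hv hab).trans ?_)
    (poincareConst_div_inradius_le_firstEigenvalue hp (isOpen_slab v a b) (convex_slab v a b))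
  rw [div_two_rpow_mul_one_div_rpow (by linarith)]
  have hr := inradius_le_of_subset_slab hv (Ω := slab v a b) fun x hx => ⟨hx.1.le, hx.2.le⟩
  have : 2 * inradius (slab v a b) ≤ ENNReal.ofReal (b - a) := by
    calc _ ≤ 2 * ENNReal.ofReal ((b - a) / 2) := by gcongr
      _ = ENNReal.ofReal (b - a) := by
        rw [← ENNReal.ofReal_ofNat 2, ← ENNReal.ofReal_mul (by simp)]
        congr 1
        ring
  gcongr

/-- The scaled eigenvalue `R_Ω^p λ_p(Ω)` of a family of open convex sets, contained in thinner and
thinner slabs and containing boxes of a fixed transverse size and of almost the same width,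
converges to `(π_p / 2)^p`. -/
theorem tendsto_inradius_rpow_mul_firstEigenvalue {p : ℝ} (hp : 1 < p)
    {v : EuclideanSpace ℝ (Fin N)} (hv : ‖v‖ = 1) {Ω : ℝ → Set (EuclideanSpace ℝ (Fin N))}
    (ho : ∀ α, IsOpen (Ω α)) (hc : ∀ α, Convex ℝ (Ω α))
    (hslab : ∀ α, 0 < α → ∀ x ∈ Ω α, 0 ≤ inner ℝ x v ∧ inner ℝ x v ≤ α)
    (hbox : ∀ ε : ℝ, 0 < ε → ε < 1 → ∃ r > 0, ∀ α, 0 < α → ∀ x,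
      inner ℝ x v ∈ Set.Ioo 0 ((1 - ε) * α) → ‖x - inner ℝ x v • v‖ ≤ r → x ∈ Ω α) :
    Tendsto (fun α => inradius (Ω α) ^ p * firstEigenvalue p (Ω α)) (𝓝[>] 0)
      (𝓝 ((poincareConst p / 2) ^ p)) := by
  have hp0 : 0 < p := by linarith
  have hR : ∀ α, 0 < α → inradius (Ω α) ≤ ENNReal.ofReal (α / 2) := fun α hα => by
    simpa using inradius_le_of_subset_slab hv (hslab α hα)
  refine tendsto_order.2 ⟨fun Y hY => ?_, fun Y hY => ?_⟩
  -- The lower bound is the Hersch–Protter inequality multiplied by the inradius to the power `p`,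
  -- which is neither `0` nor `∞`.
  · filter_upwards [self_mem_nhdsWithin] with α hα
    have hα : 0 < α := hα
    refine hY.trans_le ?_
    have hne : (Ω α).Nonempty := by
      obtain ⟨r, hr, h⟩ := hbox (1 / 2) (by norm_num) (by norm_num)
      refine ⟨_, h α hα (0 + (α / 4) • v) ?_ ?_⟩
      · rw [inner_add_smul_of_norm_eq_one hv, inner_zero_left]
        constructor <;> linarith
      · rw [inner_add_smul_of_norm_eq_one hv, inner_zero_left]
        simpa using hr.le
    have hR0 : inradius (Ω α) ^ p ≠ 0 := by
      simp [inradius_ne_zero (ho α) hne, hp0.not_gt]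
    have hRt : inradius (Ω α) ^ p ≠ ⊤ := ENNReal.rpow_ne_top_of_nonneg hp0.le
      ((hR α hα).trans_lt ENNReal.ofReal_lt_top).ne
    have := mul_le_mul_right
      (poincareConst_div_inradius_le_firstEigenvalue hp (ho α) (hc α)) (inradius (Ω α) ^ p)
    rwa [mul_left_comm, one_div, ENNReal.mul_inv_cancel hR0 hRt, mul_one] at this
  · have htop : poincareConst p ≠ ⊤ := by
      intro h
      rw [h, ENNReal.top_div_of_ne_top (by simp), ENNReal.top_rpow_of_pos hp0] at hY
      exact not_top_lt hY
    have hne : (𝓝[>] poincareConst p).NeBot := nhdsGT_neBot_of_exists_gt ⟨⊤, htop.lt_top⟩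
    have hlim : Tendsto (fun q => (q / 2) ^ p) (𝓝[>] poincareConst p)
        (𝓝 ((poincareConst p / 2) ^ p)) :=
      Tendsto.ennrpow_const p
        (ENNReal.Tendsto.div_const (tendsto_id.mono_left nhdsWithin_le_nhds) (Or.inr two_ne_zero))
    -- The order of choice matters: `q` near `π_p`, then `ε`, which fixes `r` and hence `B`, and
    -- only then `α` small enough to absorb `(α / 2) B`.
    obtain ⟨q, hqY, hq⟩ := ((hlim.eventually_lt_const hY).and self_mem_nhdsWithin).exists
    have hlim' : Tendsto (fun ε : ℝ => (q / ENNReal.ofReal (2 * (1 - ε))) ^ p) (𝓝[>] 0)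
        (𝓝 ((q / ENNReal.ofReal (2 * (1 - 0))) ^ p)) := by
      refine Tendsto.ennrpow_const p
        (ENNReal.Tendsto.const_div ?_ (Or.inl ENNReal.ofReal_ne_top))
      exact ENNReal.tendsto_ofReal
        ((tendsto_const_nhds.sub (tendsto_id.mono_left nhdsWithin_le_nhds)).const_mul 2)
    rw [sub_zero, mul_one, ENNReal.ofReal_ofNat] at hlim'
    obtain ⟨ε, hεY, hε0, hε1⟩ :=
      ((hlim'.eventually_lt_const hqY).and (Ioo_mem_nhdsGT zero_lt_one)).exists
    obtain ⟨r, hr, hbox⟩ := hbox ε hε0 hε1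
    obtain ⟨B, hB, hle⟩ := exists_firstEigenvalue_rpow_le hp hq hv hr
    have hlim'' : Tendsto (fun α : ℝ =>
        (q / ENNReal.ofReal (2 * (1 - ε)) + ENNReal.ofReal (α / 2) * B) ^ p) (𝓝[>] 0)
        (𝓝 ((q / ENNReal.ofReal (2 * (1 - ε)) + ENNReal.ofReal (0 / 2) * B) ^ p)) := by
      refine Tendsto.ennrpow_const p
        (tendsto_const_nhds.add (ENNReal.Tendsto.mul_const ?_ (Or.inr hB)))
      exact ENNReal.tendsto_ofReal ((tendsto_id.mono_left nhdsWithin_le_nhds).div_const 2)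
    rw [zero_div, ENNReal.ofReal_zero, zero_mul, add_zero] at hlim''
    filter_upwards [hlim''.eventually_lt_const hεY, self_mem_nhdsWithin] with α hα hα0
    have hα0 : 0 < α := hα0
    have h1ε : 0 < 1 - ε := sub_pos.2 hε1
    refine lt_of_le_of_lt ?_ hα
    have h1 := hle (Ω α) 0 ((1 - ε) * α) (by positivity) fun x hx => hbox α hα0 x (by
      rwa [zero_add] at hx)
    have h2 := mul_le_mul' (ENNReal.rpow_le_rpow (hR α hα0) hp0.le) h1
    refine h2.trans_eq ?_
    rw [← ENNReal.mul_rpow_of_nonneg _ _ hp0.le, mul_add]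
    congr 2
    have hα2 : 0 < α / 2 := by positivity
    rw [show (1 - ε) * α = (α / 2) * (2 * (1 - ε)) by ring, ENNReal.ofReal_mul hα2.le,
      ← mul_div_assoc, ENNReal.mul_div_mul_left _ _ (by simpa using hα0) ENNReal.ofReal_ne_top]

end Sharpness

/-! ### Pyramids -/

section Pyramid

theorem pyramid_last_mem_Icc {k : ℕ} {α : ℝ} (hα : 0 < α) {x : EuclideanSpace ℝ (Fin k)}
    (hx : x ∈ pyramid k α) {i : Fin k} (hi : (i : ℕ) + 1 = k) : x i ∈ Set.Icc 0 α := by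
  have hconv : Convex ℝ {x : EuclideanSpace ℝ (Fin k) | x i ∈ Set.Icc 0 α} :=
    (convex_Icc 0 α).is_linear_preimage (f := fun x : EuclideanSpace ℝ (Fin k) => x i)
      ⟨fun _ _ => rfl, fun _ _ => rfl⟩
  refine convexHull_min (Set.union_subset (fun y hy => ?_) ?_) hconv (interior_subset hx)
  · simp [((hy i).2 hi), hα.le]
  · rw [Set.singleton_subset_iff]
    simp [pyramidApex, hi, hα.le]

/-- The section of the pyramid at height `t α` is the base cube scaled by `1 - t`; for `t < 1 - ε`
it contains the cube of half-side `ε`, whatever `α` is. -/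
theorem mem_pyramid_of_mem_box {k : ℕ} {α ε : ℝ} (hα : 0 < α) (hε : 0 < ε)
    {x : EuclideanSpace ℝ (Fin k)} {i : Fin k} (hi : (i : ℕ) + 1 = k)
    (hxi : x i ∈ Set.Ioo 0 ((1 - ε) * α)) (hx : ∀ j, j ≠ i → |x j| < ε) : x ∈ pyramid k α := by
  set U : Set (EuclideanSpace ℝ (Fin k)) :=
    {x | x i ∈ Set.Ioo 0 ((1 - ε) * α)} ∩ ⋂ j, {x | j ≠ i → |x j| < ε} with hU
  have hUo : IsOpen U := by
    refine (isOpen_Ioo.preimage (by fun_prop : Continuous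
      fun x : EuclideanSpace ℝ (Fin k) => x i)).inter (isOpen_iInter_of_finite fun j => ?_)
    by_cases hj : j = i
    · simp [hj]
    · simpa [hj] using isOpen_lt (by fun_prop : Continuous
        fun x : EuclideanSpace ℝ (Fin k) => |x j|) continuous_const
  refine interior_maximal (fun x hx => ?_) hUo ⟨hxi, Set.mem_iInter.2 hx⟩
  obtain ⟨⟨h0, h1⟩, hx⟩ := hx
  rw [Set.mem_iInter] at hx
  set t := x i / α with ht
  have ht0 : 0 < t := div_pos h0 hα
  have ht1 : t < 1 - ε := (div_lt_iff₀ hα).2 h1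
  have hs : 0 < 1 - t := by linarith
  -- The projection of `x` from the apex onto the base plane, so that `x = (1 - t) z + t · apex`.
  set z : EuclideanSpace ℝ (Fin k) := WithLp.toLp 2 fun j => if j = i then 0 else (1 - t)⁻¹ * x j
    with hz
  have hzb : z ∈ pyramidBase k := by
    intro j
    by_cases hj : j = i
    · subst hj
      exact ⟨fun h => absurd h (by omega), fun _ => by simp [hz]⟩
    · refine ⟨fun _ => ?_, fun h => absurd (Fin.ext (by omega)) hj⟩
      have h2 : |z j| < 1 := by
        have : z j = (1 - t)⁻¹ * x j := by simp [hz, hj]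
        rw [this, abs_mul, abs_of_pos (inv_pos.2 hs), inv_mul_lt_iff₀ hs]
        linarith [hx j hj]
      exact abs_lt.1 h2
  have hcomb : x = (1 - t) • z + t • pyramidApex k α := by
    ext j
    by_cases hj : j = i
    · subst hj
      simp [hz, pyramidApex, hi, ht, hα.ne']
    · have hj' : (j : ℕ) + 1 ≠ k := fun h => hj (Fin.ext (by omega))
      simp [hz, pyramidApex, hj, hj', hs.ne']
  rw [hcomb]
  exact convex_convexHull ℝ (pyramidBase k ∪ {pyramidApex k α})
    (subset_convexHull ℝ _ (Set.mem_union_left _ hzb))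
    (subset_convexHull ℝ _ (Set.mem_union_right _ (Set.mem_singleton _))) hs.le ht0.le (by ring)

variable {N k : ℕ}

theorem isOpen_euclideanCylinder (h : k ≤ N) {D : Set (EuclideanSpace ℝ (Fin k))} (hD : IsOpen D) :
    IsOpen (euclideanCylinder h D) :=
  hD.preimage (by unfold lastCoords; fun_prop)

theorem convex_euclideanCylinder (h : k ≤ N) {D : Set (EuclideanSpace ℝ (Fin k))}
    (hD : Convex ℝ D) : Convex ℝ (euclideanCylinder h D) := by
  have hl : IsLinearMap ℝ (lastCoords h) := ⟨fun _ _ => rfl, fun _ _ => rfl⟩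
  exact hD.is_linear_preimage hl

theorem euclideanCylinder_le_rfl (D : Set (EuclideanSpace ℝ (Fin N))) :
    euclideanCylinder le_rfl D = D := by
  ext x
  have : lastCoords le_rfl x = x := by
    ext i
    simp [lastCoords]
  rw [euclideanCylinder, Set.mem_ofPred_eq, this]

theorem tendsto_euclideanCylinder_pyramid {p : ℝ} (hp : 1 < p) (hk : 1 ≤ k) (h : k ≤ N) :
    Tendsto (fun α : ℝ => inradius (euclideanCylinder h (pyramid k α)) ^ p *
      firstEigenvalue p (euclideanCylinder h (pyramid k α)))
      (𝓝[>] 0) (𝓝 ((poincareConst p / 2) ^ p)) := by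
  set m : Fin N := ⟨N - 1, by omega⟩ with hm
  set i : Fin k := ⟨k - 1, by omega⟩ with hi
  have hik : (i : ℕ) + 1 = k := by simp only [hi]; omega
  have hlast : ∀ x : EuclideanSpace ℝ (Fin N), lastCoords h x i = x m := fun x => by
    have : (⟨N - k + i, by omega⟩ : Fin N) = m := Fin.ext (by simp only [hm, hi]; omega)
    simp only [lastCoords, this]
  have hinner : ∀ x : EuclideanSpace ℝ (Fin N),
      inner ℝ x (EuclideanSpace.single m (1 : ℝ)) = x m := fun x => by
    rw [EuclideanSpace.inner_single_right]; simp
  refine tendsto_inradius_rpow_mul_firstEigenvalue hp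
    (v := EuclideanSpace.single m (1 : ℝ)) (by simp)
    (fun α => isOpen_euclideanCylinder h isOpen_interior)
    (fun α => convex_euclideanCylinder h (convex_convexHull ℝ _).interior)
    -- The radius `ε / 2` turns the non-strict transverse bound into the strict bound `ε` on each
    -- coordinate.
    (fun α hα x hx => ?_) fun ε hε hε1 => ⟨ε / 2, by positivity, fun α hα x hx hxr => ?_⟩
  · rw [hinner, ← hlast]
    exact pyramid_last_mem_Icc hα hx hik
  · rw [hinner] at hx hxr
    refine mem_pyramid_of_mem_box hα hε hik (by rwa [hlast]) fun j hj => ?_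
    set n : Fin N := ⟨N - k + j, by omega⟩ with hn
    have hnm : n ≠ m := fun heq => hj (Fin.ext (by
      have := congrArg Fin.val heq
      simp only [hn, hm, hi] at this ⊢
      omega))
    have h1 := PiLp.norm_apply_le (x - x m • EuclideanSpace.single m (1 : ℝ)) n
    have h2 : (x - x m • EuclideanSpace.single m (1 : ℝ)) n = x n := by simp [hnm]
    rw [h2, Real.norm_eq_abs] at h1
    have h3 : lastCoords h x j = x n := rfl
    rw [h3]
    linarith

end Pyramid

theorem theorem1p1 (p : ℝ) (hp : 1 < p) (N : ℕ) (hN : 1 ≤ N) :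
    (∀ Ω : Set (EuclideanSpace ℝ (Fin N)), IsOpen Ω → Convex ℝ Ω →
      (poincareConst p / 2) ^ p * (1 / inradius Ω ^ p) ≤ firstEigenvalue p Ω) ∧
    (∀ (v : EuclideanSpace ℝ (Fin N)) (a b : ℝ), ‖v‖ = 1 → a < b →
      firstEigenvalue p (slab v a b) =
        (poincareConst p / 2) ^ p * (1 / inradius (slab v a b) ^ p)) ∧
    Tendsto (fun α : ℝ => inradius (pyramid N α) ^ p * firstEigenvalue p (pyramid N α))
      (𝓝[>] 0) (𝓝 ((poincareConst p / 2) ^ p)) ∧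
    (∀ (k : ℕ) (_ : 2 ≤ k) (hk : k < N),
      Tendsto
        (fun α : ℝ => inradius (euclideanCylinder hk.le (pyramid k α)) ^ p *
          firstEigenvalue p (euclideanCylinder hk.le (pyramid k α)))
        (𝓝[>] 0) (𝓝 ((poincareConst p / 2) ^ p))) := by
  refine ⟨fun Ω ho hc => poincareConst_div_inradius_le_firstEigenvalue hp ho hc,
    fun v a b hv hab => firstEigenvalue_slab hp hv hab, ?_,
    fun k hk2 hk => tendsto_euclideanCylinder_pyramid hp (by omega) hk.le⟩
  -- The pyramid in the full space is the case `k = N`, where the cylinder has no free directions.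
  simpa only [euclideanCylinder_le_rfl] using tendsto_euclideanCylinder_pyramid hp hN (le_refl N)
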